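/- Let $n\ge 1$ and let $M=(\mathbb C^n\setminus\{0\})/\langle z\mapsto \tfrac12 z\rangle$ be the standard Hopf manifold, a complex manifold with the complex structure $J$ induced from $\mathbb C^n\setminus\{0\}$. For a Hermitian metric $g$ on $(M,J)$ (a smooth $J$-invariant Riemannian metric) with fundamental form $\omega(X,Y)=g(JX,Y)$, let $\nabla$ be its real Chern connection: the connection on $T_{\mathbb R}M$ with $\nabla g=0$ and $\nabla J=0$ whose induced connection on $T^{1,0}M$ is the Chern connection of the Hermitian holomorphic bundle $T^{1,0}M$. The metric $g$ is called real Chern-Ricci flat if $$\mathrm{Ric}(X,Y)=\sum_{i=1}^{2n} g\big(\nabla_X\nabla_{e_i}e_i-\nabla_{e_i}\nabla_Xe_i-\nabla_{[X,e_i]}e_i,\;Y\big)=0$$ for all vector fields $X,Y$, where $\{e_i\}$ is a $g$-orthonormal frame. Then $M$ is diffeomorphic to $\mathbb S^{2n-1}\times\mathbb S^1$, and $M$ carries real Chern-Ricci flat Hermitian metrics. Explicitly, there is a Hermitian metric on $M$ whose fundamental form pulls back to $$\omega=\omega_0-\frac4n\sqrt{-1}\,\partial\bar\partial\log|z|^2,\qquad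 \omega_0=\sqrt{-1}\sum_{i=1}^n\frac{4}{|z|^2}\,dz^i\wedge d\bar z^i ,$$ on $\mathbb C^n\setminus\{0\}$, and this metric is real Chern-Ricci flat. -/

import Mathlib

open scoped Manifold ContDiff Topology ComplexConjugate

noncomputable section

/-! ### Hermitian metrics and the real Chern connection on a complex manifold

A complex manifold `M` of dimension `n` is modelled on `ℂⁿ` through `𝓘(ℂ, Cn n)`; its underlying
real manifold carries the same charts, read through `𝓘(ℝ, Cn n)`. -/

/-- The space `ℂⁿ` with its standard Hermitian norm `|z|`. -/
abbrev Cn (n : ℕ) : Type := EuclideanSpace ℂ (Fin n)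

namespace ComplexManifold

section Defs

variable {n : ℕ} {M : Type*} [TopologicalSpace M] [ChartedSpace (Cn n) M]

/-- The complex structure `J` of the real tangent space `T_x M`: multiplication by `√-1` in any
holomorphic chart around `x` (`TangentSpace` uses the preferred chart at `x`). -/
def J (x : M) : TangentSpace 𝓘(ℝ, Cn n) x →L[ℝ] TangentSpace 𝓘(ℝ, Cn n) x :=
  (Complex.I • ContinuousLinearMap.id ℂ (Cn n)).restrictScalars ℝ

/-- A real vector field (not assumed to be regular), i.e. a section of `T_ℝ M`. -/
abbrev VField (n : ℕ) (M : Type*) [TopologicalSpace M] [ChartedSpace (Cn n) M] : Type _ :=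
  (x : M) → TangentSpace 𝓘(ℝ, Cn n) x

/-- `X` is differentiable (over `ℝ`) at `x`. -/
def VField.DiffAt [IsManifold 𝓘(ℝ, Cn n) ∞ M] (X : VField n M) (x : M) : Prop :=
  MDifferentiableAt 𝓘(ℝ, Cn n) 𝓘(ℝ, Cn n).tangent
    (fun y ↦ (⟨y, X y⟩ : TangentBundle 𝓘(ℝ, Cn n) M)) x

/-- `X` is smooth (over `ℝ`) at `x`. -/
def VField.SmoothAt [IsManifold 𝓘(ℝ, Cn n) ∞ M] (X : VField n M) (x : M) : Prop :=
  ContMDiffAt 𝓘(ℝ, Cn n) 𝓘(ℝ, Cn n).tangent ∞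
    (fun y ↦ (⟨y, X y⟩ : TangentBundle 𝓘(ℝ, Cn n) M)) x

/-- `X` is holomorphic in a neighbourhood of `x`: it is complex differentiable as a section of the
complex tangent bundle of `M`, which is `T_ℝ M` with the complex structure `J`. Equivalently,
the field `(X - √-1 J X) / 2` is a holomorphic section of `T^{1,0} M` near `x`. -/
def VField.HolomorphicNear [IsManifold 𝓘(ℂ, Cn n) ω M] (X : VField n M) (x : M) : Prop :=
  ∀ᶠ y in 𝓝 x, MDifferentiableAt 𝓘(ℂ, Cn n) 𝓘(ℂ, Cn n).tangent
    (fun y ↦ (⟨y, X y⟩ : TangentBundle 𝓘(ℂ, Cn n) M)) y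

/-- A Hermitian metric on `M`: a smooth Riemannian metric `g` with `g(JX, JY) = g(X, Y)`. -/
structure HermitianMetric (n : ℕ) (M : Type*) [TopologicalSpace M] [ChartedSpace (Cn n) M]
    [IsManifold 𝓘(ℝ, Cn n) ∞ M] extends
    Bundle.ContMDiffRiemannianMetric 𝓘(ℝ, Cn n) ∞ (Cn n)
      (fun x : M ↦ TangentSpace 𝓘(ℝ, Cn n) x) where
  map_J (x : M) (v w : TangentSpace 𝓘(ℝ, Cn n) x) : inner x (J x v) (J x w) = inner x v w

/-- The fundamental form `ω(X, Y) = g(JX, Y)`. -/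
def HermitianMetric.fundamentalForm [IsManifold 𝓘(ℝ, Cn n) ∞ M] (g : HermitianMetric n M) (x : M)
    (v w : TangentSpace 𝓘(ℝ, Cn n) x) : ℝ :=
  g.inner x (J x v) w

/-- An affine connection `∇` on `T_ℝ M`; `∇_v X` at `x` is `D X x v`. -/
abbrev AffineConnection (n : ℕ) (M : Type*) [TopologicalSpace M] [ChartedSpace (Cn n) M]
    [IsManifold 𝓘(ℝ, Cn n) ∞ M] : Type _ :=
  CovariantDerivative 𝓘(ℝ, Cn n) (Cn n) (fun x : M ↦ TangentSpace 𝓘(ℝ, Cn n) x)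

/-- `∇` is the real Chern connection of `(M, g, J)`: the connection on `T_ℝ M` compatible with `g`
and with `J` whose induced Hermitian connection on `T^{1,0} M` is the Chern connection, i.e. is
compatible with `∂̄`. Under the isomorphism `X ↦ (X - √-1 J X) / 2` from `(T_ℝ M, J)` to `T^{1,0} M`
the last condition, `∇_{v + √-1 J v} s = 0` for all holomorphic sections `s` and real `v`, becomes
`∇_{J v} X = J ∇_v X` for all holomorphic `X`. These conditions determine `∇ X` at every point where
`X` is differentiable, and they force `∇ X` to be smooth where `X` is. -/
structure IsRealChernConnection [IsManifold 𝓘(ℂ, Cn n) ω M] [IsManifold 𝓘(ℝ, Cn n) ∞ M]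
    (g : HermitianMetric n M) (D : AffineConnection n M) : Prop where
  compat_metric : ∀ (x : M) (X Y : VField n M), X.DiffAt x → Y.DiffAt x →
    ∀ v : TangentSpace 𝓘(ℝ, Cn n) x,
      mvfderiv 𝓘(ℝ, Cn n) (fun y ↦ g.inner y (X y) (Y y)) x v
        = g.inner x (D X x v) (Y x) + g.inner x (X x) (D Y x v)
  compat_J : ∀ (x : M) (X : VField n M), X.DiffAt x → ∀ v : TangentSpace 𝓘(ℝ, Cn n) x,
    D (fun y ↦ J y (X y)) x v = J x (D X x v)
  compat_dbar : ∀ (x : M) (X : VField n M), X.HolomorphicNear x →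
    ∀ v : TangentSpace 𝓘(ℝ, Cn n) x, D X x (J x v) = J x (D X x v)

/-- The curvature `∇_X ∇_Y Z - ∇_Y ∇_X Z - ∇_{[X,Y]} Z` of a connection. -/
def curvature [IsManifold 𝓘(ℝ, Cn n) ∞ M] (D : AffineConnection n M) (X Y Z : VField n M) :
    VField n M := fun x ↦
  D (fun y ↦ D Z y (Y y)) x (X x) - D (fun y ↦ D Z y (X y)) x (Y x)
    - D Z x (VectorField.mlieBracket 𝓘(ℝ, Cn n) X Y x)

/-- The Ricci curvature `∑ᵢ R(X, eᵢ, eᵢ, Y)` at `x`, where `R(X, Y, Z, W) = g(R(X, Y) Z, W)`,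
computed with the frame `e₁, …, e₂ₙ`. -/
def ricci [IsManifold 𝓘(ℝ, Cn n) ∞ M] (g : HermitianMetric n M) (D : AffineConnection n M)
    (e : Fin (2 * n) → VField n M) (X Y : VField n M) (x : M) : ℝ :=
  ∑ i, g.inner x (curvature D X (e i) (e i) x) (Y x)

/-- `Ric(∇, g) = 0`: the Ricci curvature vanishes at every point on all fields, whatever smooth
fields `e₁, …, e₂ₙ`, orthonormal at the point, are used to compute it. -/
def IsRicciFlat [IsManifold 𝓘(ℝ, Cn n) ∞ M] (g : HermitianMetric n M)
    (D : AffineConnection n M) : Prop :=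
  ∀ (x : M) (e : Fin (2 * n) → VField n M) (X Y : VField n M),
    (∀ i, (e i).SmoothAt x) → X.SmoothAt x → Y.SmoothAt x →
    (∀ i j, g.inner x (e i x) (e j x) = if i = j then 1 else 0) →
    ricci g D e X Y x = 0

/-- The metric `g` is real Chern-Ricci flat: the real Chern connection has `Ric = 0`. Its existence
is part of the definition. -/
def IsRealChernRicciFlat [IsManifold 𝓘(ℂ, Cn n) ω M] [IsManifold 𝓘(ℝ, Cn n) ∞ M]
    (g : HermitianMetric n M) : Prop :=
  (∃ D : AffineConnection n M, IsRealChernConnection g D) ∧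
    ∀ D : AffineConnection n M, IsRealChernConnection g D → IsRicciFlat g D

end Defs

end ComplexManifold

/-! ### Real `(1,1)`-forms on domains of `ℂⁿ` -/

namespace CnForms

variable {n : ℕ}

/-- The Wirtinger derivative `∂f/∂zⁱ = (∂f/∂xⁱ - √-1 ∂f/∂yⁱ) / 2`. -/
def dz (i : Fin n) (f : Cn n → ℂ) (z : Cn n) : ℂ :=
  (fderiv ℝ f z (EuclideanSpace.single i 1)
    - Complex.I * fderiv ℝ f z (EuclideanSpace.single i Complex.I)) / 2

/-- The Wirtinger derivative `∂f/∂z̄ʲ = (∂f/∂xʲ + √-1 ∂f/∂yʲ) / 2`. -/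
def dzbar (j : Fin n) (f : Cn n → ℂ) (z : Cn n) : ℂ :=
  (fderiv ℝ f z (EuclideanSpace.single j 1)
    + Complex.I * fderiv ℝ f z (EuclideanSpace.single j Complex.I)) / 2

/-- The value at `(v, w)` of the 2-form `√-1 ∑ h_{i j̄} dzⁱ ∧ dz̄ʲ`. -/
def form11 (h : Fin n → Fin n → ℂ) (v w : Cn n) : ℂ :=
  Complex.I * ∑ i, ∑ j, h i j * (v i * conj (w j) - w i * conj (v j))

/-- The form `√-1 ∂∂̄ f` at `z`. -/
def ddbar (f : Cn n → ℂ) (z v w : Cn n) : ℂ :=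
  form11 (fun i j ↦ dz i (dzbar j f) z) v w

/-- The form `ω₀ = √-1 ∑ (4 δ_{i j} / |z|²) dzⁱ ∧ dz̄ʲ` at `z`. -/
def omega0 (z v w : Cn n) : ℂ :=
  form11 (fun i j ↦ if i = j then 4 / (‖z‖ : ℂ) ^ 2 else 0) v w

/-- The form `ω₀ - (4/n) √-1 ∂∂̄ log |z|²` at `z`. -/
def omegaHopf (z v w : Cn n) : ℂ :=
  omega0 z v w - 4 / (n : ℂ) * ddbar (fun u ↦ ((Real.log (‖u‖ ^ 2) : ℝ) : ℂ)) z v w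

end CnForms

/-! ### The standard Hopf manifold -/

/-- The open set `ℂⁿ ∖ {0}`. -/
def puncturedOpens (n : ℕ) : TopologicalSpace.Opens (Cn n) := ⟨{0}ᶜ, isOpen_compl_singleton⟩

/-- `ℂⁿ ∖ {0}` as a complex manifold. -/
abbrev Punctured (n : ℕ) : Type := puncturedOpens n

namespace Punctured

variable {n : ℕ}

/-- The identity chart of `ℂⁿ`, restricted to `ℂⁿ ∖ {0}`. -/
instance : ChartedSpace (Cn n) (Punctured n) :=
  @TopologicalSpace.Opens.instChartedSpace _ _ _ _ (chartedSpaceSelf (Cn n)) (puncturedOpens n)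

lemma ne_zero (z : Punctured n) : (z : Cn n) ≠ 0 := z.2

/-- The action of the infinite cyclic group generated by `z ↦ z / 2`. -/
instance : AddAction ℤ (Punctured n) where
  vadd k z := ⟨((1 / 2 : ℝ) ^ k) • (z : Cn n),
    smul_ne_zero (zpow_ne_zero _ (by norm_num)) z.ne_zero⟩
  zero_vadd z := Subtype.ext (by
    change ((1 / 2 : ℝ) ^ (0 : ℤ)) • (z : Cn n) = z
    simp)
  add_vadd j k z := Subtype.ext (by
    change ((1 / 2 : ℝ) ^ (j + k)) • (z : Cn n) = ((1 / 2 : ℝ) ^ j) • ((1 / 2 : ℝ) ^ k) • (z : Cn n)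
    rw [zpow_add₀ (by norm_num), mul_smul])

lemma coe_vadd (k : ℤ) (z : Punctured n) :
    ((k +ᵥ z : Punctured n) : Cn n) = ((1 / 2 : ℝ) ^ k) • (z : Cn n) := rfl

lemma norm_vadd (k : ℤ) (z : Punctured n) :
    ‖((k +ᵥ z : Punctured n) : Cn n)‖ = (1 / 2 : ℝ) ^ k * ‖(z : Cn n)‖ := by
  rw [coe_vadd, norm_smul, Real.norm_of_nonneg (by positivity)]

instance : ContinuousConstVAdd ℤ (Punctured n) where
  continuous_const_vadd k := by
    refine Continuous.subtype_mk (f := fun z : Punctured n ↦ ((1 / 2 : ℝ) ^ k) • (z : Cn n)) ?_ _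
    fun_prop

instance : IsCancelVAdd ℤ (Punctured n) where
  left_cancel' k a b h := by simpa using congrArg (fun c ↦ -k +ᵥ c) h
  right_cancel' j k z h := by
    have h1 : (1 / 2 : ℝ) ^ j * ‖(z : Cn n)‖ = (1 / 2 : ℝ) ^ k * ‖(z : Cn n)‖ := by
      rw [← norm_vadd, ← norm_vadd, h]
    have h2 := mul_right_cancel₀ (norm_ne_zero_iff.2 z.ne_zero) h1
    exact zpow_right_injective₀ (by norm_num) (by norm_num) h2

instance : LocallyCompactSpace (Punctured n) :=
  (puncturedOpens n).isOpen.locallyCompactSpace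

instance : ProperlyDiscontinuousVAdd ℤ (Punctured n) where
  finite_disjoint_inter_image {K L} hK hL := by
    let f : Punctured n → ℝ := fun z ↦ Real.log ‖(z : Cn n)‖ / Real.log 2
    have hlog : Real.log 2 ≠ 0 := (Real.log_pos one_lt_two).ne'
    have hf : Continuous f := by
      refine Continuous.div_const (Continuous.log ?_ fun z ↦ norm_ne_zero_iff.2 z.ne_zero) _
      exact continuous_subtype_val.norm
    have hfk (k : ℤ) (z : Punctured n) : f (k +ᵥ z) = f z - k := by
      simp only [f]
      rw [norm_vadd, Real.log_mul (zpow_ne_zero _ (by norm_num)) (norm_ne_zero_iff.2 z.ne_zero),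
        Real.log_zpow, one_div, Real.log_inv]
      field_simp
      ring
    obtain ⟨R, hR⟩ := (hK.image hf).isBounded.exists_norm_le
    obtain ⟨S, hS⟩ := (hL.image hf).isBounded.exists_norm_le
    refine (Set.finite_Icc (-⌈R + S⌉) ⌈R + S⌉).subset ?_
    rintro k hk
    obtain ⟨_, ⟨z, hz, rfl⟩, hw⟩ := hk
    have h1 := abs_le.1 (hR _ ⟨z, hz, rfl⟩)
    have h2 := abs_le.1 (hS _ ⟨_, hw, rfl⟩)
    simp only at h2
    rw [hfk] at h2
    have h3 := Int.le_ceil (R + S)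
    constructor
    · have : (-(⌈R + S⌉ : ℝ)) ≤ (k : ℝ) := by linarith
      exact_mod_cast this
    · have : (k : ℝ) ≤ (⌈R + S⌉ : ℝ) := by linarith
      exact_mod_cast this

end Punctured

/-- The standard Hopf manifold `(ℂⁿ ∖ {0}) / ⟨z ↦ z / 2⟩`, with the charts induced from
`ℂⁿ ∖ {0}` (local inverses of the quotient map). -/
abbrev Hopf (n : ℕ) : Type := AddAction.orbitRel.Quotient ℤ (Punctured n)

namespace Hopf

variable {n : ℕ}

/-- The quotient map `ℂⁿ ∖ {0} → Hopf n`. -/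
def proj (z : Punctured n) : Hopf n := Quotient.mk _ z

lemma proj_eq_iff {z w : Punctured n} : proj z = proj w ↔ ∃ k : ℤ, k +ᵥ w = z :=
  Quotient.eq.trans AddAction.orbitRel_apply

lemma isLocalHomeomorph_proj : IsLocalHomeomorph (proj (n := n)) :=
  isAddQuotientCoveringMap_quotientMk_of_properlyDiscontinuousVAdd.isCoveringMap.isLocalHomeomorph

/-- The charts are local inverses of the quotient map. -/
lemma exists_of_mem_atlas {e : OpenPartialHomeomorph (Hopf n) (Cn n)}
    (he : e ∈ atlas (Cn n) (Hopf n)) {u : Cn n} (hu : u ∈ e.target) :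
    ∃ z : Punctured n, (z : Cn n) = u ∧ proj z = e.symm u := by
  obtain ⟨q, rfl⟩ := he
  have hs := OpenPartialHomeomorph.map_target _ hu
  have hr := OpenPartialHomeomorph.right_inv _ hu
  refine ⟨_, hr, ?_⟩
  rw [OpenPartialHomeomorph.trans_source] at hs
  exact isLocalHomeomorph_proj.apply_localInverseAt_of_mem hs.1

/-- The changes of charts are locally multiplication by a power of `1 / 2`. -/
lemma transition {e e' : OpenPartialHomeomorph (Hopf n) (Cn n)}
    (he : e ∈ atlas (Cn n) (Hopf n)) (he' : e' ∈ atlas (Cn n) (Hopf n)) {u : Cn n}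
    (hu : u ∈ (e.symm.trans e').source) :
    ∃ c : ℝ, ∀ᶠ v in 𝓝 u, e' (e.symm v) = c • v := by
  have hu1 : u ∈ e.target := hu.1
  have hu2 : e.symm u ∈ e'.source := hu.2
  obtain ⟨z, hz, hpz⟩ := exists_of_mem_atlas he hu1
  obtain ⟨z', hz', hpz'⟩ := exists_of_mem_atlas he' (e'.map_source hu2)
  rw [e'.left_inv hu2, ← hpz] at hpz'
  obtain ⟨k, hk⟩ := proj_eq_iff.1 hpz'
  obtain ⟨U, hU, hzU, hinj⟩ := isLocalHomeomorph_proj.isLocallyInjective z'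
  obtain ⟨U', hU', rfl⟩ := isOpen_induced_iff.1 hU
  refine ⟨(1 / 2 : ℝ) ^ k, ?_⟩
  have hcont : ContinuousAt (fun v ↦ e' (e.symm v)) u :=
    (e.symm.trans e').continuousAt hu
  have ev1 : ∀ᶠ v in 𝓝 u, e' (e.symm v) ∈ U' :=
    hcont.eventually_mem (hU'.mem_nhds (by rw [← hz']; exact hzU))
  have hcont2 : ContinuousAt (fun v : Cn n ↦ ((1 / 2 : ℝ) ^ k) • v) u := by fun_prop
  have ev2 : ∀ᶠ v in 𝓝 u, ((1 / 2 : ℝ) ^ k) • v ∈ U' :=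
    hcont2.eventually_mem (hU'.mem_nhds (by
      rw [← hz, ← Punctured.coe_vadd, hk]
      exact hzU))
  filter_upwards [ev1, ev2, (e.symm.trans e').open_source.mem_nhds hu] with v h1 h2 hv
  have hv2 : e.symm v ∈ e'.source := hv.2
  obtain ⟨w, hw, hpw⟩ := exists_of_mem_atlas he hv.1
  obtain ⟨w', hw', hpw'⟩ := exists_of_mem_atlas he' (e'.map_source hv2)
  rw [e'.left_inv hv2, ← hpw] at hpw'
  have hkw : ((k +ᵥ w : Punctured n) : Cn n) = ((1 / 2 : ℝ) ^ k) • v := by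
    rw [Punctured.coe_vadd, hw]
  have := hinj (x₁ := w') (x₂ := k +ᵥ w) (by
    change (w' : Cn n) ∈ U'
    rw [hw']
    exact h1) (by
    change ((k +ᵥ w : Punctured n) : Cn n) ∈ U'
    rw [hkw]
    exact h2) (hpw'.trans (proj_eq_iff.2 ⟨-k, by simp⟩))
  change e' (e.symm v) = _
  rw [← hw', this, hkw]

instance isManifold_complex (k : ℕ∞ω) : IsManifold 𝓘(ℂ, Cn n) k (Hopf n) := by
  refine isManifold_of_contDiffOn _ _ _ fun e e' he he' u hu ↦ ?_
  have hu' : u ∈ (e.symm.trans e').source := by simpa using hu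
  obtain ⟨c, hc⟩ := transition he he' hu'
  refine ContDiffAt.contDiffWithinAt (ContDiffAt.congr_of_eventuallyEq (f := fun v ↦ c • v) ?_ ?_)
  · fun_prop
  · exact hc

instance isManifold_real (k : ℕ∞ω) : IsManifold 𝓘(ℝ, Cn n) k (Hopf n) := by
  refine isManifold_of_contDiffOn _ _ _ fun e e' he he' u hu ↦ ?_
  have hu' : u ∈ (e.symm.trans e').source := by simpa using hu
  obtain ⟨c, hc⟩ := transition he he' hu'
  refine ContDiffAt.contDiffWithinAt (ContDiffAt.congr_of_eventuallyEq (f := fun v ↦ c • v) ?_ ?_)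
  · fun_prop
  · exact hc

end Hopf

/-- `dim_ℝ ℂⁿ = (2n - 1) + 1`, so that the unit sphere of `ℂⁿ` is the manifold `S^{2n-1}`. -/
instance fact_finrank_Cn (n : ℕ) [NeZero n] :
    Fact (Module.finrank ℝ (Cn n) = (2 * n - 1) + 1) := ⟨by
  have h1 : Module.finrank ℝ (Cn n) = 2 * n := by
    rw [← Module.finrank_mul_finrank ℝ ℂ (Cn n)]
    simp
  have := NeZero.pos n
  omega⟩

end

open scoped Manifold ContDiff Topology ComplexConjugate

noncomputable section

/-! Everything is computed upstairs on `ℂⁿ ∖ {0}` and descends because it is invariant under real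
dilations. Write ℓ = `dlog` = ∂ log|z|², P = `perp` for the projection killing the radial line, and
L = `levi` for ∂∂̄ log|z|², which is the flat metric over |z|² composed with P. The Hermitian matrix
of the metric is (4/|z|²)(1 - 1/n) on the complement of the radial line and 4/|z|² on that line,
hence positive for n ≥ 2. For n = 1 only the radial line is left. The Chern connection form h⁻¹∂h is
then v, w ↦ -ℓ(v) w + (n-1)⁻¹ ℓ(w) P v (`christoffel`).

The derivative of ℓ has (0,1)-part L and (1,0)-part -ℓ ⊗ ℓ, so the curvature is the
antisymmetrization of `curvAux` (`curvature_nabla`), which is linear in L. Trace it over a real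
orthonormal frame. Complex linear f give ∑ f(eᵢ) eᵢ = 0, so half of the terms vanish. In the other
half, with a = 4(1 - 1/n), one has ∑ L(eᵢ, v) eᵢ = a⁻¹ P v and ∑ L(eᵢ, eᵢ) = a⁻¹(n - 1). The scalar
term of the connection contributes a⁻¹ P v and the (n-1)⁻¹ term contributes its negative
(`sum_curvAux`). This cancellation is what the coefficient 4/n is chosen for.

On the quotient, changes of charts are dilations, so the coordinate formulas define a metric and a
connection. Any connection with the three Chern properties agrees with this one on differentiable
fields (`coordDeriv_eq`), so flatness for one gives it for all. The diffeomorphism sends z to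
(z/|z|, exp(2πi log|z| / log 2)). -/

namespace HopfMetric

variable {n : ℕ}

/-! ### Logarithmic forms and the connection form on `ℂⁿ ∖ {0}` -/

/-- The `(1,0)`-form `∂ log |z|²` at `u`. -/
def dlog (u : Cn n) : Cn n →L[ℂ] ℂ := ((‖u‖ : ℂ) ^ 2)⁻¹ • innerSL ℂ u

lemma dlog_apply (u v : Cn n) : dlog u v = ((‖u‖ : ℂ) ^ 2)⁻¹ * inner ℂ u v := by
  simp [dlog]

/-- The orthogonal projection onto the complement of the complex line through `u`. -/
def perp (u : Cn n) : Cn n →L[ℂ] Cn n := ContinuousLinearMap.id ℂ (Cn n) - (dlog u).smulRight u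

lemma perp_apply (u v : Cn n) : perp u v = v - dlog u v • u := by simp [perp]

/-- The Hermitian form `∂∂̄ log |z|²` at `u`, conjugate linear in the first variable. -/
def levi (u v w : Cn n) : ℂ := ((‖u‖ : ℂ) ^ 2)⁻¹ * inner ℂ v (perp u w)

/-- The connection form of the Chern connection in the standard coordinates. -/
def christoffel (u : Cn n) : Cn n →L[ℂ] Cn n →L[ℂ] Cn n :=
  -- The first term differentiates the factor 1/|u|². In the second, (n-1)⁻¹ is 1/n divided by 1 -
  -- 1/n, the eigenvalue transverse to the radial line. For n = 1 the inverse is 0 by convention,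
  -- and `perp` vanishes anyway.
  -(dlog u).smulRight (ContinuousLinearMap.id ℂ (Cn n))
    + ((n : ℂ) - 1)⁻¹ • ((dlog u).smulRight (perp u)).flip

lemma christoffel_apply (u v w : Cn n) :
    christoffel u v w = -(dlog u v • w) + ((n : ℂ) - 1)⁻¹ • dlog u w • perp u v := by
  simp [christoffel]

lemma sq_norm_ne_zero {u : Cn n} (hu : u ≠ 0) : ((‖u‖ : ℂ) ^ 2) ≠ 0 := by
  simpa using hu

lemma dlog_self {u : Cn n} (hu : u ≠ 0) : dlog u u = 1 := by
  rw [dlog_apply, inner_self_eq_norm_sq_to_K]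
  exact inv_mul_cancel₀ (sq_norm_ne_zero hu)

lemma dlog_perp {u : Cn n} (hu : u ≠ 0) (v : Cn n) : dlog u (perp u v) = 0 := by
  rw [perp_apply, map_sub, map_smul, dlog_self hu]
  simp

lemma perp_self {u : Cn n} (hu : u ≠ 0) : perp u u = 0 := by
  rw [perp_apply, dlog_self hu, one_smul, sub_self]

lemma levi_eq (u v w : Cn n) :
    levi u v w = ((‖u‖ : ℂ) ^ 2)⁻¹ * inner ℂ v w - conj (dlog u v) * dlog u w := by
  rw [levi, perp_apply, inner_sub_right, inner_smul_right, dlog_apply u v, map_mul, inner_conj_symm]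
  simp only [map_inv₀, map_pow, Complex.conj_ofReal]
  ring

/-- In dimension one the radial line is the whole space. This settles every case where n - 1 cannot
be inverted. -/
lemma perp_eq_zero {u : Cn n} (hn : n = 1) (hu : u ≠ 0) (v : Cn n) : perp u v = 0 := by
  subst hn
  have h : u 0 ≠ 0 := fun h ↦ hu (by ext i; fin_cases i; simpa using h)
  obtain ⟨c, rfl⟩ : ∃ c : ℂ, v = c • u :=
    ⟨v 0 / u 0, by ext i; fin_cases i; simp [div_mul_cancel₀ _ h]⟩
  rw [map_smul, perp_self hu, smul_zero]

/-! ### Invariance under dilations -/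

section scaling

variable {c : ℝ}

lemma dlog_smul_smul (hc : c ≠ 0) (u v : Cn n) : dlog (c • u) (c • v) = dlog u v := by
  have h : (c : ℂ) ≠ 0 := by exact_mod_cast hc
  rw [dlog_apply, dlog_apply, norm_smul, ← Complex.coe_smul, ← Complex.coe_smul, inner_smul_left,
    inner_smul_right, Complex.conj_ofReal, Complex.ofReal_mul, mul_pow, ← Complex.ofReal_pow ‖c‖,
    Real.norm_eq_abs, sq_abs, Complex.ofReal_pow, mul_inv]
  field_simp

lemma perp_smul_smul (hc : c ≠ 0) (u v : Cn n) : perp (c • u) (c • v) = c • perp u v := by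
  rw [perp_apply, perp_apply, dlog_smul_smul hc, smul_sub, smul_comm]

lemma christoffel_smul (hc : c ≠ 0) (u v w : Cn n) :
    christoffel (c • u) (c • v) (c • w) = c • christoffel u v w := by
  rw [christoffel_apply, christoffel_apply, dlog_smul_smul hc, dlog_smul_smul hc,
    perp_smul_smul hc, smul_add, smul_neg, smul_comm c, smul_comm c, smul_comm c]

end scaling

/-! ### Derivatives of the forms -/

section derivatives

variable {u : Cn n} {Y Z : Cn n → Cn n}

/-- Quotient rule for ⟨x, Y⟩/⟨x, x⟩. With Y fixed, the part conjugate linear in v is the Levi form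
and the part linear in v is -ℓ(v)ℓ(Y). -/
lemma hasFDerivAt_dlog {Y' : Cn n →L[ℝ] Cn n} (hu : u ≠ 0) (hY : HasFDerivAt Y Y' u) :
    ∃ L : Cn n →L[ℝ] ℂ, HasFDerivAt (fun x ↦ dlog x (Y x)) L u ∧
      ∀ v, L v = levi u v (Y u) - dlog u v * dlog u (Y u) + dlog u (Y' v) := by
  have h0 : inner ℂ u u ≠ 0 := inner_self_ne_zero.2 hu
  have hid := hasFDerivAt_id (𝕜 := ℝ) u
  have h1 : (fun x ↦ dlog x (Y x)) = fun x ↦ inner ℂ x (Y x) * (inner ℂ x x)⁻¹ := by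
    funext x
    rw [dlog_apply, inner_self_eq_norm_sq_to_K, mul_comm]
    rfl
  rw [h1]
  have h3 : HasFDerivAt (fun x : Cn n ↦ (inner ℂ x x : ℂ)) _ u := HasFDerivAt.inner ℂ hid hid
  refine ⟨_, (HasFDerivAt.inner ℂ hid hY).mul (HasFDerivAt.comp u (hasFDerivAt_inv' h0) h3),
    fun v ↦ ?_⟩
  have h2 : ((‖u‖ : ℂ) ^ 2) = inner ℂ u u := (inner_self_eq_norm_sq_to_K (𝕜 := ℂ) u).symm
  simp only [levi_eq, dlog_apply, h2, map_mul, map_inv₀, inner_conj_symm]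
  simp [fderivInnerCLM_apply]
  field_simp
  ring

lemma fderiv_dlog (hu : u ≠ 0) (hY : DifferentiableAt ℝ Y u) (v : Cn n) :
    fderiv ℝ (fun x ↦ dlog x (Y x)) u v
      = levi u v (Y u) - dlog u v * dlog u (Y u) + dlog u (fderiv ℝ Y u v) := by
  obtain ⟨L, hL, h⟩ := hasFDerivAt_dlog hu hY.hasFDerivAt
  rw [hL.fderiv, h]

lemma differentiableAt_dlog (hu : u ≠ 0) (hY : DifferentiableAt ℝ Y u) :
    DifferentiableAt ℝ (fun x ↦ dlog x (Y x)) u := by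
  obtain ⟨L, hL, -⟩ := hasFDerivAt_dlog hu hY.hasFDerivAt
  exact hL.differentiableAt

lemma differentiableAt_perp (hu : u ≠ 0) (hY : DifferentiableAt ℝ Y u) :
    DifferentiableAt ℝ (fun x ↦ perp x (Y x)) u := by
  simp only [perp_apply]
  exact hY.fun_sub ((differentiableAt_dlog hu hY).fun_smul differentiableAt_fun_id)

lemma differentiableAt_christoffel (hu : u ≠ 0) (hY : DifferentiableAt ℝ Y u)
    (hZ : DifferentiableAt ℝ Z u) : DifferentiableAt ℝ (fun x ↦ christoffel x (Y x) (Z x)) u := by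
  simp only [christoffel_apply]
  exact (((differentiableAt_dlog hu hY).fun_smul hZ).fun_neg).fun_add
    (((differentiableAt_dlog hu hZ).fun_smul (differentiableAt_perp hu hY)).fun_const_smul _)

lemma fderiv_perp (hu : u ≠ 0) (hY : DifferentiableAt ℝ Y u) (v : Cn n) :
    fderiv ℝ (fun x ↦ perp x (Y x)) u v
      = perp u (fderiv ℝ Y u v) - (levi u v (Y u) - dlog u v * dlog u (Y u)) • u
        - dlog u (Y u) • v := by
  simp only [perp_apply]
  rw [fderiv_fun_sub hY ((differentiableAt_dlog hu hY).fun_smul differentiableAt_fun_id)]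
  rw [fderiv_fun_smul (differentiableAt_dlog hu hY) differentiableAt_fun_id]
  simp [fderiv_dlog hu hY]
  module

lemma fderiv_christoffel (hu : u ≠ 0) (hY : DifferentiableAt ℝ Y u) (hZ : DifferentiableAt ℝ Z u)
    (v : Cn n) :
    fderiv ℝ (fun x ↦ christoffel x (Y x) (Z x)) u v
      = christoffel u (fderiv ℝ Y u v) (Z u) + christoffel u (Y u) (fderiv ℝ Z u v)
        - (levi u v (Y u) - dlog u v * dlog u (Y u)) • Z u
        + ((n : ℂ) - 1)⁻¹ • ((levi u v (Z u) - dlog u v * dlog u (Z u)) • perp u (Y u)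
          - dlog u (Z u) • ((levi u v (Y u) - dlog u v * dlog u (Y u)) • u + dlog u (Y u) • v)) := by
  have hdY := differentiableAt_dlog hu hY
  have hdZ := differentiableAt_dlog hu hZ
  have hp := differentiableAt_perp hu hY
  simp only [christoffel_apply]
  rw [fderiv_fun_add (hdY.fun_smul hZ).fun_neg ((hdZ.fun_smul hp).fun_const_smul _), fderiv_fun_neg,
    fderiv_fun_const_smul (hdZ.fun_smul hp), fderiv_fun_smul hdY hZ, fderiv_fun_smul hdZ hp]
  simp [fderiv_dlog hu hY, fderiv_dlog hu hZ, fderiv_perp hu hY]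
  module

end derivatives

/-! ### The metric on `ℂⁿ ∖ {0}` -/

/-- The Hermitian form with coefficients `(4 / |u|²) ((1 - 1/n) δ_ij + (1/n) ū_i u_j / |u|²)`. -/
def herm (u v w : Cn n) : ℂ :=
  4 * ((1 - (n : ℂ)⁻¹) * (((‖u‖ : ℂ) ^ 2)⁻¹ * inner ℂ w v)
    + (n : ℂ)⁻¹ * (dlog u v * conj (dlog u w)))

lemma herm_add_left (u v v' w : Cn n) : herm u (v + v') w = herm u v w + herm u v' w := by
  simp only [herm, map_add, inner_add_right]
  ring

lemma herm_smul_left (u v w : Cn n) (c : ℂ) : herm u (c • v) w = c * herm u v w := by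
  simp only [herm, map_smul, inner_smul_right, smul_eq_mul]
  ring

lemma conj_herm (u v w : Cn n) : conj (herm u v w) = herm u w v := by
  simp only [herm, map_mul, map_add, map_sub, map_inv₀, map_pow, Complex.conj_ofReal, map_one,
    map_natCast, Complex.conj_conj, inner_conj_symm, map_ofNat]
  ring

lemma herm_smul_smul {c : ℝ} (hc : c ≠ 0) (u v w : Cn n) :
    herm (c • u) (c • v) (c • w) = herm u v w := by
  have h : (c : ℂ) ≠ 0 := by exact_mod_cast hc
  rw [herm, herm, dlog_smul_smul hc, dlog_smul_smul hc, norm_smul, ← Complex.coe_smul,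
    ← Complex.coe_smul, inner_smul_left,
    inner_smul_right, Complex.conj_ofReal, Complex.ofReal_mul, mul_pow, ← Complex.ofReal_pow ‖c‖,
    Real.norm_eq_abs, sq_abs, Complex.ofReal_pow, mul_inv]
  field_simp

/-- The Riemannian metric `2 Re` of `herm`. -/
def metric (u : Cn n) : Cn n →L[ℝ] Cn n →L[ℝ] ℝ :=
  LinearMap.toContinuousBilinearMap <| LinearMap.mk₂ ℝ (fun v w ↦ 2 * (herm u v w).re)
    (fun v v' w ↦ by rw [herm_add_left, Complex.add_re, mul_add])
    (fun c v w ↦ by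
      rw [← Complex.coe_smul, herm_smul_left, Complex.re_ofReal_mul, smul_eq_mul, mul_left_comm])
    (fun v w w' ↦ by
      rw [← conj_herm, herm_add_left, Complex.conj_re, Complex.add_re, mul_add,
        ← conj_herm u w, ← conj_herm u w', Complex.conj_re, Complex.conj_re])
    (fun c v w ↦ by
      rw [← conj_herm, ← Complex.coe_smul, herm_smul_left, Complex.conj_re, Complex.re_ofReal_mul,
        smul_eq_mul, mul_left_comm, ← conj_herm u v w, Complex.conj_re])

lemma metric_apply (u v w : Cn n) : metric u v w = 2 * (herm u v w).re := rfl

lemma metric_comm (u v w : Cn n) : metric u v w = metric u w v := by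
  rw [metric_apply, metric_apply, ← conj_herm, Complex.conj_re]

lemma metric_I_I (u v w : Cn n) : metric u (Complex.I • v) (Complex.I • w) = metric u v w := by
  rw [metric_apply, metric_apply, herm_smul_left, ← conj_herm, herm_smul_left, map_mul, conj_herm]
  simp [← mul_assoc]

lemma metric_I_right (u v w : Cn n) :
    metric u v (Complex.I • w) = -metric u (Complex.I • v) w := by
  rw [← metric_I_I u v, ← smul_assoc, smul_eq_mul, Complex.I_mul_I, neg_one_smul, map_neg]

lemma metric_smul_smul {c : ℝ} (hc : c ≠ 0) (u v w : Cn n) :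
    metric (c • u) (c • v) (c • w) = metric u v w := by
  rw [metric_apply, metric_apply, herm_smul_smul hc]

lemma norm_sq_eq_of_dim_one {u : Cn n} (hn : n = 1) (hu : u ≠ 0) (v : Cn n) :
    (‖u‖ ^ 2)⁻¹ * ‖v‖ ^ 2 = ‖dlog u v‖ ^ 2 := by
  have h := perp_eq_zero hn hu v
  rw [perp_apply, sub_eq_zero] at h
  conv_lhs => rw [h]
  rw [norm_smul]
  have := norm_ne_zero_iff.2 hu
  field_simp

lemma metric_self (u v : Cn n) :
    metric u v v = 8 * ((1 - (n : ℝ)⁻¹) * ((‖u‖ ^ 2)⁻¹ * ‖v‖ ^ 2) + (n : ℝ)⁻¹ * ‖dlog u v‖ ^ 2) := by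
  have : herm u v v = ((4 * ((1 - (n : ℝ)⁻¹) * ((‖u‖ ^ 2)⁻¹ * ‖v‖ ^ 2)
      + (n : ℝ)⁻¹ * ‖dlog u v‖ ^ 2) : ℝ) : ℂ) := by
    rw [herm, Complex.mul_conj, Complex.normSq_eq_norm_sq, inner_self_eq_norm_sq_to_K]
    push_cast
    rfl
  rw [metric_apply, this, Complex.ofReal_re]
  ring

/-- For n ≥ 2 the first term suffices, since 1 - 1/n ≥ 1/n. For n = 1 that term vanishes and the
radial term is already the full norm. The bound gives both positivity and boundedness of the unit
ball. -/
lemma le_metric_self [NeZero n] {u : Cn n} (hu : u ≠ 0) (v : Cn n) :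
    8 / n * ((‖u‖ ^ 2)⁻¹ * ‖v‖ ^ 2) ≤ metric u v v := by
  rw [metric_self]
  rcases Nat.lt_or_ge 1 n with hn | hn
  · have h1 : (2 : ℝ) ≤ n := by exact_mod_cast hn
    have h2 : (n : ℝ)⁻¹ ≤ 1 - (n : ℝ)⁻¹ := by
      have : (n : ℝ)⁻¹ ≤ 2⁻¹ := inv_anti₀ (by norm_num) h1
      linarith
    have h3 : 0 ≤ (n : ℝ)⁻¹ * ‖dlog u v‖ ^ 2 := by positivity
    have h4 : (n : ℝ)⁻¹ * ((‖u‖ ^ 2)⁻¹ * ‖v‖ ^ 2) ≤ (1 - (n : ℝ)⁻¹) * ((‖u‖ ^ 2)⁻¹ * ‖v‖ ^ 2) :=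
      mul_le_mul_of_nonneg_right h2 (by positivity)
    rw [div_eq_mul_inv]
    linarith
  · have hn1 : n = 1 := le_antisymm hn (NeZero.pos n)
    rw [norm_sq_eq_of_dim_one hn1 hu]
    have h1 : (n : ℝ) = 1 := by exact_mod_cast hn1
    simp [h1]

lemma metric_self_pos [NeZero n] {u v : Cn n} (hu : u ≠ 0) (hv : v ≠ 0) : 0 < metric u v v := by
  refine lt_of_lt_of_le ?_ (le_metric_self hu v)
  have := norm_pos_iff.2 hu
  have := norm_pos_iff.2 hv
  have := NeZero.pos n
  positivity

lemma isVonNBounded_metric [NeZero n] {u : Cn n} (hu : u ≠ 0) :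
    Bornology.IsVonNBounded ℝ {v : Cn n | metric u v v < 1} := by
  rw [NormedSpace.isVonNBounded_iff, isBounded_iff_forall_norm_le]
  have h1 := norm_pos_iff.2 hu
  have h2 : (0 : ℝ) < n := by exact_mod_cast NeZero.pos n
  refine ⟨Real.sqrt (n / 8 * ‖u‖ ^ 2), fun v hv ↦ Real.le_sqrt_of_sq_le ?_⟩
  have h := (le_metric_self hu v).trans hv.le
  calc ‖v‖ ^ 2 = n / 8 * ‖u‖ ^ 2 * (8 / n * ((‖u‖ ^ 2)⁻¹ * ‖v‖ ^ 2)) := by field_simp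
    _ ≤ n / 8 * ‖u‖ ^ 2 * 1 := mul_le_mul_of_nonneg_left h (by positivity)
    _ = _ := mul_one _

lemma contDiffAt_dlog {u : Cn n} (hu : u ≠ 0) (v : Cn n) :
    ContDiffAt ℝ ∞ (fun x ↦ dlog x v) u := by
  have h : (fun x ↦ dlog x v) = fun x ↦ (((‖x‖ ^ 2)⁻¹ : ℝ) : ℂ) * inner ℂ x v := by
    funext x
    rw [dlog_apply]
    push_cast
    rfl
  rw [h]
  refine ContDiffAt.mul ?_ (contDiffAt_id.inner ℂ contDiffAt_const)
  exact Complex.ofRealCLM.contDiff.contDiffAt.comp u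
    (((contDiff_norm_sq ℂ).contDiffAt).inv (by simpa using hu))

lemma contDiffAt_metric {u : Cn n} (hu : u ≠ 0) : ContDiffAt ℝ ∞ (metric (n := n)) u := by
  refine ContDiffOn.contDiffAt (s := {0}ᶜ) ?_ (isOpen_compl_singleton.mem_nhds hu)
  rw [contDiffOn_clm_apply]
  intro v
  rw [contDiffOn_clm_apply]
  intro w u hu
  refine ContDiffAt.contDiffWithinAt ?_
  simp only [metric_apply]
  suffices h : ContDiffAt ℝ ∞ (fun x ↦ herm x v w) u from
    contDiffAt_const.mul (Complex.reCLM.contDiff.contDiffAt.comp u h)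
  simp only [herm]
  have h1 : ContDiffAt ℝ ∞ (fun x : Cn n ↦ ((‖x‖ : ℂ) ^ 2)⁻¹) u := by
    have := Complex.ofRealCLM.contDiff.contDiffAt.comp u
      (((contDiff_norm_sq (E := Cn n) ℂ).contDiffAt (x := u)).inv (by simpa using hu)) (n := ∞)
    refine this.congr_of_eventuallyEq (.of_forall fun x ↦ ?_)
    simp
  have h2 : ContDiffAt ℝ ∞ (fun x : Cn n ↦ conj (dlog x w)) u :=
    Complex.conjCLE.contDiff.contDiffAt.comp u (contDiffAt_dlog hu w)
  exact contDiffAt_const.mul ((contDiffAt_const.mul (h1.mul contDiffAt_const)).add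
    (contDiffAt_const.mul ((contDiffAt_dlog hu v).mul h2)))

/-! ### Compatibility of the connection with the metric -/

section compatibility

variable {u : Cn n} {Y Z : Cn n → Cn n}

lemma smul_inv_sub_one_smul_perp [NeZero n] (hu : u ≠ 0) (v : Cn n) :
    (1 - (n : ℂ)⁻¹) • ((n : ℂ) - 1)⁻¹ • perp u v = (n : ℂ)⁻¹ • perp u v := by
  rcases eq_or_ne n 1 with hn | hn
  · simp [perp_eq_zero hn hu]
  · have h1 : (n : ℂ) - 1 ≠ 0 := sub_ne_zero.2 (by exact_mod_cast hn)
    have h2 : (n : ℂ) ≠ 0 := by exact_mod_cast NeZero.ne n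
    rw [smul_smul]
    congr 1
    field_simp

/-- The right-hand side is the (1,0)-derivative in the direction v of the coefficients of the
Hermitian form, so this is h·(h⁻¹∂h) = ∂h. -/
lemma herm_christoffel [NeZero n] (hu : u ≠ 0) (v w y : Cn n) :
    herm u (christoffel u v w) y
      = 4 * (-(1 - (n : ℂ)⁻¹) * dlog u v * (((‖u‖ : ℂ) ^ 2)⁻¹ * inner ℂ y w)
        + (n : ℂ)⁻¹ * dlog u w * (((‖u‖ : ℂ) ^ 2)⁻¹ * inner ℂ y v
          - 2 * dlog u v * conj (dlog u y))) := by
  have h0 := congrArg (fun x ↦ (inner ℂ y x : ℂ)) (smul_inv_sub_one_smul_perp hu v)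
  simp only [inner_smul_right] at h0
  have h1 : inner ℂ y (perp u v) = inner ℂ y v - dlog u v * inner ℂ y u := by
    rw [perp_apply, inner_sub_right, inner_smul_right]
  have h2 : ((‖u‖ : ℂ) ^ 2)⁻¹ * inner ℂ y u = conj (dlog u y) := by
    rw [dlog_apply, map_mul, inner_conj_symm]
    simp
  rw [herm, christoffel_apply, map_add, map_neg, map_smul, map_smul, map_smul, dlog_perp hu,
    inner_add_right, inner_neg_right, inner_smul_right, inner_smul_right, inner_smul_right]
  have h3 : (1 - (n : ℂ)⁻¹) * (((‖u‖ : ℂ) ^ 2)⁻¹ *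
      (((n : ℂ) - 1)⁻¹ * (dlog u w * inner ℂ y (perp u v))))
      = (n : ℂ)⁻¹ * dlog u w * (((‖u‖ : ℂ) ^ 2)⁻¹ * inner ℂ y v
          - dlog u v * conj (dlog u y)) := by
    rw [← h2]
    calc _ = ((‖u‖ : ℂ) ^ 2)⁻¹ * dlog u w *
          ((1 - (n : ℂ)⁻¹) * (((n : ℂ) - 1)⁻¹ * inner ℂ y (perp u v))) := by ring
      _ = _ := by
        rw [h0, h1]
        ring
  simp only [mul_add, h3, smul_eq_mul]
  ring

lemma hasFDerivAt_inv_norm_sq (hu : u ≠ 0) :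
    ∃ L : Cn n →L[ℝ] ℂ, HasFDerivAt (fun x : Cn n ↦ ((‖x‖ : ℂ) ^ 2)⁻¹) L u ∧
      ∀ v, L v = -((‖u‖ : ℂ) ^ 2)⁻¹ * (dlog u v + conj (dlog u v)) := by
  have h0 : inner ℂ u u ≠ 0 := inner_self_ne_zero.2 hu
  have hid := hasFDerivAt_id (𝕜 := ℝ) u
  have h3 : HasFDerivAt (fun x : Cn n ↦ (inner ℂ x x : ℂ)) _ u := HasFDerivAt.inner ℂ hid hid
  have h1 : (fun x : Cn n ↦ ((‖x‖ : ℂ) ^ 2)⁻¹) = fun x ↦ (inner ℂ x x)⁻¹ := by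
    funext x
    rw [inner_self_eq_norm_sq_to_K]
    rfl
  rw [h1]
  refine ⟨_, HasFDerivAt.comp u (hasFDerivAt_inv' h0) h3, fun v ↦ ?_⟩
  have h2 : ((‖u‖ : ℂ) ^ 2) = inner ℂ u u := (inner_self_eq_norm_sq_to_K (𝕜 := ℂ) u).symm
  simp only [dlog_apply, h2, map_mul, map_inv₀, inner_conj_symm]
  simp [fderivInnerCLM_apply]
  field_simp

/-- The (1,0)-part of dh is absorbed by the connection acting on Y. The (0,1)-part is its conjugate
and is absorbed by the connection acting on Z. -/
lemma hasFDerivAt_herm [NeZero n] {Y' Z' : Cn n →L[ℝ] Cn n} (hu : u ≠ 0) (hY : HasFDerivAt Y Y' u)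
    (hZ : HasFDerivAt Z Z' u) :
    ∃ L : Cn n →L[ℝ] ℂ, HasFDerivAt (fun x ↦ herm x (Y x) (Z x)) L u ∧
      ∀ v, L v = herm u (Y' v + christoffel u v (Y u)) (Z u)
        + herm u (Y u) (Z' v + christoffel u v (Z u)) := by
  obtain ⟨N, hN, hN'⟩ := hasFDerivAt_inv_norm_sq hu
  obtain ⟨A, hA, hA'⟩ := hasFDerivAt_dlog hu hY
  obtain ⟨B, hB, hB'⟩ := hasFDerivAt_dlog hu hZ
  have hB2 := Complex.conjCLE.toContinuousLinearMap.hasFDerivAt.comp u hB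
  refine ⟨_, ((((hN.mul (HasFDerivAt.inner ℂ hZ hY)).const_mul (1 - (n : ℂ)⁻¹)).add
    ((hA.mul hB2).const_mul (n : ℂ)⁻¹)).const_mul 4), fun v ↦ ?_⟩
  have h : herm u (Y u) (Z' v + christoffel u v (Z u))
      = conj (herm u (Z' v) (Y u)) + conj (herm u (christoffel u v (Z u)) (Y u)) := by
    rw [← map_add, ← herm_add_left, conj_herm]
  rw [h, herm_add_left, herm_christoffel hu, herm_christoffel hu, conj_herm]
  simp [fderivInnerCLM_apply, hN', hA', hB', levi_eq, herm, inner_conj_symm, map_ofNat]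
  ring

lemma fderiv_metric [NeZero n] (hu : u ≠ 0) (hY : DifferentiableAt ℝ Y u)
    (hZ : DifferentiableAt ℝ Z u) (v : Cn n) :
    fderiv ℝ (fun x ↦ metric x (Y x) (Z x)) u v
      = metric u (fderiv ℝ Y u v + christoffel u v (Y u)) (Z u)
        + metric u (Y u) (fderiv ℝ Z u v + christoffel u v (Z u)) := by
  obtain ⟨L, hL, hL'⟩ := hasFDerivAt_herm hu hY.hasFDerivAt hZ.hasFDerivAt
  have h : HasFDerivAt (fun x ↦ metric x (Y x) (Z x)) _ u :=
    (Complex.reCLM.hasFDerivAt.comp u hL).const_mul 2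
  rw [h.fderiv]
  simp only [smul_apply, ContinuousLinearMap.comp_apply, hL', metric_apply,
    Complex.reCLM_apply, Complex.add_re, smul_eq_mul, mul_add]

end compatibility

/-! ### Curvature in coordinates -/

section curvature

/-- `curvAux u v w X - curvAux u w v X` is the curvature of the Chern connection. -/
def curvAux (u v w X : Cn n) : Cn n :=
  -(levi u v w • X) + ((n : ℂ) - 1)⁻¹ •
    (levi u v X • perp u w - (dlog u X * levi u v w) • u)

variable {u : Cn n} {X Y Z : Cn n → Cn n}

/-- The covariant derivative `∇_Y Z` of the Chern connection in coordinates. -/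
def nabla (Y Z : Cn n → Cn n) (u : Cn n) : Cn n :=
  fderiv ℝ Z u (Y u) + christoffel u (Y u) (Z u)

lemma differentiableAt_nabla (hu : u ≠ 0) (hY : DifferentiableAt ℝ Y u)
    (hZ : ContDiffAt ℝ 2 Z u) : DifferentiableAt ℝ (nabla Y Z) u := by
  have h2 : DifferentiableAt ℝ (fderiv ℝ Z) u :=
    (hZ.fderiv_right (m := 1) (by norm_num)).differentiableAt one_ne_zero
  exact (h2.clm_apply hY).fun_add (differentiableAt_christoffel hu hY
    (hZ.differentiableAt two_ne_zero))

lemma fderiv_nabla (hu : u ≠ 0) (hY : DifferentiableAt ℝ Y u)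
    (hZ : ContDiffAt ℝ 2 Z u) (v : Cn n) :
    fderiv ℝ (nabla Y Z) u v = fderiv ℝ (fderiv ℝ Z) u v (Y u) + fderiv ℝ Z u (fderiv ℝ Y u v)
      + fderiv ℝ (fun x ↦ christoffel x (Y x) (Z x)) u v := by
  have h2 : DifferentiableAt ℝ (fderiv ℝ Z) u :=
    (hZ.fderiv_right (m := 1) (by norm_num)).differentiableAt one_ne_zero
  have h3 := differentiableAt_christoffel hu hY (hZ.differentiableAt two_ne_zero)
  have h4 : nabla Y Z = fun x ↦ fderiv ℝ Z x (Y x) + christoffel x (Y x) (Z x) := rfl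
  rw [h4, fderiv_fun_add (h2.clm_apply hY) h3, fderiv_clm_apply h2 hY]
  simp
  abel

/-- Second derivatives of Z cancel by symmetry, and the derivatives of X and Y are removed by the
bracket. The terms quadratic in ℓ also cancel, so only Levi terms survive, depending on the values
of the fields at the point alone. -/
lemma curvature_nabla (hu : u ≠ 0) (hX : DifferentiableAt ℝ X u) (hY : DifferentiableAt ℝ Y u)
    (hZ : ContDiffAt ℝ 2 Z u) :
    nabla X (nabla Y Z) u - nabla Y (nabla X Z) u
      - nabla (fun x ↦ fderiv ℝ Y x (X x) - fderiv ℝ X x (Y x)) Z u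
      = curvAux u (X u) (Y u) (Z u) - curvAux u (Y u) (X u) (Z u) := by
  have hZ1 := hZ.differentiableAt two_ne_zero
  have hsymm : fderiv ℝ (fderiv ℝ Z) u (X u) (Y u) = fderiv ℝ (fderiv ℝ Z) u (Y u) (X u) :=
    (hZ.isSymmSndFDerivAt (by simp)).eq (X u) (Y u)
  rw [nabla, nabla, nabla, fderiv_nabla hu hY hZ, fderiv_nabla hu hX hZ, hsymm,
    fderiv_christoffel hu hY hZ1, fderiv_christoffel hu hX hZ1]
  simp only [nabla, christoffel_apply, curvAux, map_sub, map_add, map_neg, map_smul, perp_apply,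
    dlog_self hu, sub_apply]
  module

end curvature

/-! ### Traces over real orthonormal frames -/

section orthonormal

variable {u : Cn n} {e : Fin (2 * n) → Cn n}

lemma finrank_real_Cn (n : ℕ) : Module.finrank ℝ (Cn n) = 2 * n := by
  rw [← Module.finrank_mul_finrank ℝ ℂ (Cn n)]
  simp

lemma sum_metric_smul (he : ∀ i j, metric u (e i) (e j) = if i = j then 1 else 0) (y : Cn n) :
    ∑ i, metric u (e i) y • e i = y := by
  have hlin : LinearIndependent ℝ e := by
    rw [Fintype.linearIndependent_iff]
    intro c hc i
    have := congrArg (metric u (e i)) hc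
    simpa [map_sum, he] using this
  have hcard : Fintype.card (Fin (2 * n)) = Module.finrank ℝ (Cn n) := by
    rw [finrank_real_Cn, Fintype.card_fin]
  obtain hn | hn := isEmpty_or_nonempty (Fin (2 * n))
  · have : Subsingleton (Cn n) := by
      rw [← Module.finrank_zero_iff (R := ℝ), ← hcard]
      simp
    exact Subsingleton.elim _ _
  let b := basisOfLinearIndependentOfCardEqFinrank hlin hcard
  have hb (i) : b i = e i := by simp [b]
  have hy : y = ∑ j, b.repr y j • e j := by
    conv_lhs => rw [← b.sum_repr y]
    simp [hb]
  conv_rhs => rw [hy]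
  refine Finset.sum_congr rfl fun i _ ↦ ?_
  congr 1
  conv_lhs => rw [hy]
  simp [map_sum, he]

lemma sum_metric_sq (he : ∀ i j, metric u (e i) (e j) = if i = j then 1 else 0) (y : Cn n) :
    ∑ i, metric u (e i) y ^ 2 = metric u y y := by
  have h := congrArg (metric u y) (sum_metric_smul he y)
  rw [← h, map_sum]
  refine Finset.sum_congr rfl fun i _ ↦ ?_
  rw [map_smul, smul_eq_mul, metric_comm u y, sq]

/-- Traces of complex linear and conjugate linear forms with real part `metric u · y`. -/
lemma sum_conj_smul (he : ∀ i j, metric u (e i) (e j) = if i = j then 1 else 0) {y : Cn n}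
    {f : Cn n →ₗ[ℂ] ℂ} (hf : ∀ v, metric u v y = (f v).re) :
    ∑ i, conj (f (e i)) • e i = (2 : ℝ) • y := by
  have h1 : ∑ i, (f (e i)).re • e i = y := by
    simp only [← hf]
    exact sum_metric_smul he y
  -- Im f(v) = -Re f(iv) = -g(iv, y) = g(v, iy), so the imaginary parts expand iy in the frame.
  have h2 : ∑ i, (f (e i)).im • e i = Complex.I • y := by
    rw [← sum_metric_smul he (Complex.I • y)]
    refine Finset.sum_congr rfl fun i _ ↦ ?_
    rw [metric_I_right, hf, map_smul]
    simp
  have h3 (i) : conj (f (e i)) • e i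
      = (f (e i)).re • e i - Complex.I • (f (e i)).im • e i := by
    rw [← Complex.coe_smul, ← Complex.coe_smul, smul_smul, ← sub_smul]
    congr 1
    apply Complex.ext <;> simp
  rw [Finset.sum_congr rfl fun i _ ↦ h3 i, Finset.sum_sub_distrib, ← Finset.smul_sum, h1, h2,
    smul_smul, Complex.I_mul_I, two_smul]
  simp

/-- If y represents Re f, then iy represents Im f, and the sum is y + i(iy) = 0. -/
lemma sum_smul_eq_zero (he : ∀ i j, metric u (e i) (e j) = if i = j then 1 else 0)
    (f : Cn n →ₗ[ℂ] ℂ) : ∑ i, f (e i) • e i = 0 := by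
  set y : Cn n := ∑ i, (f (e i)).re • e i with hy
  have hf (v) : metric u v y = (f v).re := by
    conv_rhs => rw [← sum_metric_smul he v]
    rw [hy, map_sum, map_sum, Complex.re_sum]
    refine Finset.sum_congr rfl fun i _ ↦ ?_
    rw [map_smul, metric_comm, LinearMap.map_smul_of_tower, Complex.smul_re, smul_eq_mul,
      smul_eq_mul, mul_comm]
  have h2 : ∑ i, (f (e i)).im • e i = Complex.I • y := by
    rw [← sum_metric_smul he (Complex.I • y)]
    refine Finset.sum_congr rfl fun i _ ↦ ?_
    rw [metric_I_right, hf, map_smul]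
    simp
  have h3 (i) : f (e i) • e i
      = (f (e i)).re • e i + Complex.I • (f (e i)).im • e i := by
    rw [← Complex.coe_smul, ← Complex.coe_smul, smul_smul, ← add_smul]
    congr 1
    apply Complex.ext <;> simp
  rw [Finset.sum_congr rfl fun i _ ↦ h3 i, Finset.sum_add_distrib, ← Finset.smul_sum, ← hy, h2,
    smul_smul, Complex.I_mul_I]
  simp

end orthonormal

/-! ### Vanishing of the Ricci trace -/

section ricci

variable {u : Cn n} {e : Fin (2 * n) → Cn n}

lemma conj_levi (u v w : Cn n) : conj (levi u v w) = levi u w v := by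
  simp only [levi_eq, map_sub, map_mul, map_inv₀, map_pow, Complex.conj_ofReal, Complex.conj_conj,
    inner_conj_symm]
  ring

lemma levi_perp_right (hu : u ≠ 0) (v w : Cn n) : levi u v (perp u w) = levi u v w := by
  rw [levi, levi, perp_apply u (perp u w), dlog_perp hu, zero_smul, sub_zero]

/-- Transversally to the radial line the metric is a multiple of the Levi form. This turns traces of
the Levi form into metric traces. -/
lemma metric_perp_right (hu : u ≠ 0) (v w : Cn n) :
    metric u v (perp u w) = 8 * (1 - (n : ℝ)⁻¹) * (levi u w v).re := by
  have h : herm u v (perp u w) = ((4 * (1 - (n : ℝ)⁻¹) : ℝ) : ℂ) * levi u w v := by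
    rw [herm, dlog_perp hu, ← conj_levi u, ← levi_perp_right hu, conj_levi u, levi_eq,
      dlog_perp hu]
    push_cast
    simp
    ring
  rw [metric_apply, h, Complex.re_ofReal_mul]
  ring

/-- `levi u v` as a complex linear form. -/
def leviForm (u v : Cn n) : Cn n →ₗ[ℂ] ℂ where
  toFun w := levi u v w
  map_add' w w' := by simp only [levi, map_add, inner_add_right, mul_add]
  map_smul' c w := by
    simp only [levi, map_smul, inner_smul_right, RingHom.id_apply, smul_eq_mul]
    ring

lemma sum_levi_smul (hu : u ≠ 0) (he : ∀ i j, metric u (e i) (e j) = if i = j then 1 else 0)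
    (v : Cn n) : (4 * (1 - (n : ℝ)⁻¹)) • ∑ i, levi u (e i) v • e i = perp u v := by
  have h := sum_conj_smul he (y := perp u v)
    (f := ((8 * (1 - (n : ℝ)⁻¹) : ℝ) : ℂ) • leviForm u v) (fun w ↦ by
      rw [metric_perp_right hu]
      simp only [LinearMap.smul_apply, smul_eq_mul, Complex.re_ofReal_mul]
      rfl)
  have h2 (i) : conj ((((8 * (1 - (n : ℝ)⁻¹) : ℝ) : ℂ) • leviForm u v) (e i)) • e i
      = (8 * (1 - (n : ℝ)⁻¹)) • levi u (e i) v • e i := by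
    rw [LinearMap.smul_apply, smul_eq_mul, map_mul, Complex.conj_ofReal, mul_smul, Complex.coe_smul,
      ← conj_levi u]
    rfl
  rw [Finset.sum_congr rfl fun i _ ↦ h2 i, ← Finset.smul_sum] at h
  have h3 := congrArg (fun x ↦ (2 : ℝ)⁻¹ • x) h
  simp only [smul_smul] at h3
  rw [inv_mul_cancel₀ two_ne_zero, one_smul] at h3
  rw [← h3]
  congr 1
  ring

lemma metric_self_right (hu : u ≠ 0) (v : Cn n) (c : ℂ) (hn : n ≠ 0) :
    metric u v (c • u) = 8 * (dlog u v * conj c).re := by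
  have h0 : (n : ℂ) ≠ 0 := by exact_mod_cast hn
  have h : herm u v (c • u) = 4 * (dlog u v * conj c) := by
    rw [herm, map_smul, dlog_self hu, inner_smul_left, dlog_apply]
    simp
    ring
  rw [metric_apply, h]
  simp
  ring

/-- Up to scale this is the trace of P. The real trace is 2n minus the contribution of the radial
plane, spanned by u and iu, each of squared length 8. -/
lemma sum_levi_self (hu : u ≠ 0) (hn : n ≠ 0)
    (he : ∀ i j, metric u (e i) (e j) = if i = j then 1 else 0) :
    ((4 * (1 - (n : ℝ)⁻¹) : ℝ) : ℂ) * ∑ i, levi u (e i) (e i) = n - 1 := by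
  have h0 : (n : ℝ) ≠ 0 := by exact_mod_cast hn
  have h1 (i) : levi u (e i) (e i) = ((levi u (e i) (e i)).re : ℂ) := by
    exact (Complex.conj_eq_iff_re.1 (conj_levi u _ _)).symm
  have h6 (v) : metric u v u = 8 * (dlog u v).re := by
    simpa using metric_self_right hu v 1 hn
  have h2 (i) : 8 * (1 - (n : ℝ)⁻¹) * (levi u (e i) (e i)).re
      = 1 - (metric u (e i) u ^ 2 + metric u (e i) (Complex.I • u) ^ 2) / 8 := by
    rw [← metric_perp_right hu, perp_apply, map_sub, he, if_pos rfl, metric_self_right hu _ _ hn,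
      metric_self_right hu _ _ hn, h6]
    simp [Complex.mul_re]
    ring
  have h3 : metric u u u = 8 := by
    rw [h6, dlog_self hu]
    simp
  have h4 : 8 * (1 - (n : ℝ)⁻¹) * ∑ i, (levi u (e i) (e i)).re = 2 * n - 2 := by
    rw [Finset.mul_sum, Finset.sum_congr rfl fun i _ ↦ h2 i, Finset.sum_sub_distrib,
      ← Finset.sum_div, Finset.sum_add_distrib, sum_metric_sq he, sum_metric_sq he, metric_I_I, h3]
    simp
    norm_num
  rw [Finset.sum_congr rfl fun i _ ↦ h1 i, ← Complex.ofReal_sum, ← Complex.ofReal_mul]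
  have h5 : 4 * (1 - (n : ℝ)⁻¹) * ∑ i, (levi u (e i) (e i)).re = n - 1 := by linarith
  rw [h5]
  push_cast
  rfl

/-- The third Ricci curvature of the Chern connection vanishes. -/
lemma sum_curvAux (hu : u ≠ 0) (hn : n ≠ 0)
    (he : ∀ i j, metric u (e i) (e j) = if i = j then 1 else 0) (v : Cn n) :
    ∑ i, (curvAux u v (e i) (e i) - curvAux u (e i) v (e i)) = 0 := by
  rcases eq_or_ne n 1 with hn1 | hn1
  · refine Finset.sum_eq_zero fun i _ ↦ ?_
    simp [curvAux, levi, perp_eq_zero hn1 hu]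
  have h0 := sum_smul_eq_zero he (leviForm u v)
  change ∑ i, levi u v (e i) • e i = 0 at h0
  have hR : (1 - (n : ℝ)⁻¹) ≠ 0 := by
    rw [sub_ne_zero]
    intro h
    exact hn1 (by exact_mod_cast inv_eq_one.1 h.symm)
  have hC : (n : ℂ) - 1 ≠ 0 := sub_ne_zero.2 (by exact_mod_cast hn1)
  set a : ℝ := 4 * (1 - (n : ℝ)⁻¹) with ha
  have ha0 : a ≠ 0 := mul_ne_zero four_ne_zero hR
  have h1 : ∑ i, levi u (e i) v • e i = a⁻¹ • perp u v := by
    rw [← sum_levi_smul hu he v, smul_smul, inv_mul_cancel₀ ha0, one_smul]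
  have h2 : ∑ i, levi u (e i) (e i) = (a : ℂ)⁻¹ * (n - 1) := by
    rw [← sum_levi_self hu hn he, ← mul_assoc, inv_mul_cancel₀ (by exact_mod_cast ha0), one_mul]
  have h3 : ∑ i, levi u v (e i) • perp u (e i) = 0 := by
    simpa using congrArg (perp u) h0
  have h4 : ∑ i, dlog u (e i) * levi u v (e i) = 0 := by
    have := congrArg (dlog u) h0
    rw [map_sum, map_zero] at this
    rw [← this]
    exact Finset.sum_congr rfl fun i _ ↦ by rw [map_smul, smul_eq_mul, mul_comm]
  have h5 : ∑ i, dlog u (e i) * levi u (e i) v = 0 := by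
    have := congrArg (dlog u) h1
    rw [map_sum, ContinuousLinearMap.map_smul_of_tower, dlog_perp hu, smul_zero] at this
    rw [← this]
    exact Finset.sum_congr rfl fun i _ ↦ by rw [map_smul, smul_eq_mul, mul_comm]
  simp only [curvAux, Finset.sum_sub_distrib, Finset.sum_add_distrib, Finset.sum_neg_distrib,
    ← Finset.smul_sum, ← Finset.sum_smul, h0, h1, h2, h3, h4, h5]
  rw [← Complex.coe_smul]
  simp only [neg_zero, zero_smul, sub_zero, smul_zero, add_zero, smul_smul, zero_sub]
  -- The factor n - 1 from the trace of the Levi form cancels the (n-1)⁻¹ of the connection, leaving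
  -- a⁻¹ P v - a⁻¹ P v.
  rw [mul_comm _ ((n : ℂ) - 1), inv_mul_cancel_left₀ hC, Complex.ofReal_inv]
  simp

end ricci

end HopfMetric

/-! ### Charts of the Hopf manifold and vector fields in charts -/

namespace Hopf

variable {n : ℕ}

lemma proj_symm_chartAt (x : Hopf n) {u : Cn n} (hu : u ∈ (chartAt (Cn n) x).target) :
    ∃ h : u ≠ 0, proj ⟨u, h⟩ = (chartAt (Cn n) x).symm u := by
  obtain ⟨z, rfl, hz'⟩ := exists_of_mem_atlas (chart_mem_atlas _ x) hu
  exact ⟨z.ne_zero, hz'⟩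

lemma chartAt_ne_zero {x y : Hopf n} (hy : y ∈ (chartAt (Cn n) x).source) :
    chartAt (Cn n) x y ≠ 0 :=
  (proj_symm_chartAt x ((chartAt (Cn n) x).map_source hy)).choose

lemma proj_chartAt {x y : Hopf n} (hy : y ∈ (chartAt (Cn n) x).source) :
    proj ⟨chartAt (Cn n) x y, chartAt_ne_zero hy⟩ = y := by
  obtain ⟨h, h'⟩ := proj_symm_chartAt x ((chartAt (Cn n) x).map_source hy)
  rw [h', (chartAt (Cn n) x).left_inv hy]

lemma continuous_proj : Continuous (proj (n := n)) := isLocalHomeomorph_proj.continuous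

/-- In the charts, the quotient map is locally the multiplication by a power of `1 / 2`. -/
lemma eventually_chartAt_proj (x : Hopf n) {z : Punctured n}
    (hz : proj z ∈ (chartAt (Cn n) x).source) :
    ∃ k : ℤ, ∀ᶠ w in 𝓝 z, chartAt (Cn n) x (proj w) = (1 / 2 : ℝ) ^ k • (w : Cn n) := by
  set e := chartAt (Cn n) x with he
  obtain ⟨k, hk⟩ := proj_eq_iff.1 (proj_chartAt hz)
  obtain ⟨U, hU, hzU, hinj⟩ := isLocalHomeomorph_proj.isLocallyInjective
    (⟨e (proj z), chartAt_ne_zero hz⟩ : Punctured n)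
  obtain ⟨U', hU', rfl⟩ := isOpen_induced_iff.1 hU
  refine ⟨k, ?_⟩
  have hc : ContinuousAt (fun w ↦ e (proj w)) z :=
    (e.continuousAt hz).comp continuous_proj.continuousAt
  have ev1 : ∀ᶠ w in 𝓝 z, e (proj w) ∈ U' := hc.eventually_mem (hU'.mem_nhds hzU)
  have ev2 : ∀ᶠ w in 𝓝 z, k +ᵥ w ∈ (Subtype.val ⁻¹' U' : Set (Punctured n)) :=
    (continuous_const_vadd k).continuousAt.eventually_mem (hU.mem_nhds (by rwa [hk]))
  have ev3 : ∀ᶠ w in 𝓝 z, proj w ∈ e.source :=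
    continuous_proj.continuousAt.eventually_mem (e.open_source.mem_nhds hz)
  filter_upwards [ev1, ev2, ev3] with w h1 h2 h3
  have := hinj (x₁ := ⟨e (proj w), chartAt_ne_zero h3⟩) (x₂ := k +ᵥ w) h1 h2
    ((proj_chartAt h3).trans (proj_eq_iff.2 ⟨-k, by simp⟩))
  rw [← Punctured.coe_vadd, ← this]

/-- The dilation factor of the change of charts at `y` from the chart at `y` to that at `x`. -/
def ratio (x y : Hopf n) : ℝ := ‖chartAt (Cn n) x y‖ / ‖chartAt (Cn n) y y‖

lemma ratio_pos {x y : Hopf n} (hy : y ∈ (chartAt (Cn n) x).source) : 0 < ratio x y :=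
  div_pos (norm_pos_iff.2 (chartAt_ne_zero hy))
    (norm_pos_iff.2 (chartAt_ne_zero (mem_chart_source _ y)))

lemma ratio_self (x : Hopf n) : ratio x x = 1 :=
  div_self (norm_ne_zero_iff.2 (chartAt_ne_zero (mem_chart_source _ x)))

lemma eventually_chartAt_symm {x y : Hopf n} (hy : y ∈ (chartAt (Cn n) x).source) :
    ∀ᶠ u in 𝓝 (chartAt (Cn n) y y), chartAt (Cn n) x ((chartAt (Cn n) y).symm u) = ratio x y • u := by
  have hyy := mem_chart_source (Cn n) y
  have hpy := proj_chartAt hyy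
  obtain ⟨k, hk⟩ := eventually_chartAt_proj x (z := ⟨chartAt (Cn n) y y, chartAt_ne_zero hyy⟩)
    (by rwa [hpy])
  have hk0 := hk.self_of_nhds
  rw [hpy] at hk0
  have hr : ratio x y = (1 / 2 : ℝ) ^ k := by
    rw [ratio, hk0, norm_smul, Real.norm_of_nonneg (by positivity), mul_div_assoc, div_self, mul_one]
    exact norm_ne_zero_iff.2 (chartAt_ne_zero hyy)
  rw [nhds_induced (Subtype.val : Punctured n → Cn n), Filter.eventually_comap] at hk
  filter_upwards [hk, (chartAt (Cn n) y).open_target.mem_nhds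
    ((chartAt (Cn n) y).map_source hyy)] with u h1 h2
  obtain ⟨h3, h4⟩ := proj_symm_chartAt y h2
  rw [← h4, hr]
  exact h1 ⟨u, h3⟩ rfl

lemma ratio_smul {x y : Hopf n} (hy : y ∈ (chartAt (Cn n) x).source) :
    ratio x y • chartAt (Cn n) y y = chartAt (Cn n) x y := by
  have h := (eventually_chartAt_symm hy).self_of_nhds
  rw [(chartAt (Cn n) y).left_inv (mem_chart_source _ y)] at h
  exact h.symm

/-- A tangent vector at y is recorded in the preferred chart at y. Passing to the chart at x
multiplies it by the derivative of the chart change, a dilation. -/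
lemma trivializationAt_real {x y : Hopf n} (hy : y ∈ (chartAt (Cn n) x).source)
    (v : TangentSpace 𝓘(ℝ, Cn n) y) :
    (trivializationAt (Cn n) (TangentSpace 𝓘(ℝ, Cn n)) x ⟨y, v⟩).2
      = ratio x y • (show Cn n from v) := by
  rw [TangentBundle.trivializationAt_apply]
  have h : (chartAt (Cn n) x).extend 𝓘(ℝ, Cn n) ∘ ((chartAt (Cn n) y).extend 𝓘(ℝ, Cn n)).symm
      =ᶠ[𝓝 (chartAt (Cn n) y y)] fun u ↦ ratio x y • u := eventually_chartAt_symm hy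
  have h2 : HasFDerivAt (fun u : Cn n ↦ ratio x y • u) (ratio x y • ContinuousLinearMap.id ℝ (Cn n))
      (chartAt (Cn n) y y) := (hasFDerivAt_id _).fun_const_smul _
  change fderivWithin ℝ _ (Set.range id) (chartAt (Cn n) y y) v = _
  rw [Set.range_id, fderivWithin_univ, h.fderiv_eq, h2.fderiv]
  rfl

lemma trivializationAt_complex {x y : Hopf n} (hy : y ∈ (chartAt (Cn n) x).source)
    (v : TangentSpace 𝓘(ℂ, Cn n) y) :
    (trivializationAt (Cn n) (TangentSpace 𝓘(ℂ, Cn n)) x ⟨y, v⟩).2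
      = ratio x y • (show Cn n from v) := by
  rw [TangentBundle.trivializationAt_apply]
  have h : (chartAt (Cn n) x).extend 𝓘(ℂ, Cn n) ∘ ((chartAt (Cn n) y).extend 𝓘(ℂ, Cn n)).symm
      =ᶠ[𝓝 (chartAt (Cn n) y y)] fun u ↦ ratio x y • u := eventually_chartAt_symm hy
  have h2 : HasFDerivAt (fun u : Cn n ↦ ratio x y • u) (ratio x y • ContinuousLinearMap.id ℂ (Cn n))
      (chartAt (Cn n) y y) := (hasFDerivAt_id _).fun_const_smul _
  change fderivWithin ℂ _ (Set.range id) (chartAt (Cn n) y y) v = _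
  rw [Set.range_id, fderivWithin_univ, h.fderiv_eq, h2.fderiv]
  rfl

open ComplexManifold

/-- The coordinate expression of a vector field in the chart at `x`. -/
def rep (x : Hopf n) (X : VField n (Hopf n)) (u : Cn n) : Cn n :=
  ratio x ((chartAt (Cn n) x).symm u) • (show Cn n from X ((chartAt (Cn n) x).symm u))

lemma rep_chartAt {x y : Hopf n} (hy : y ∈ (chartAt (Cn n) x).source) (X : VField n (Hopf n)) :
    rep x X (chartAt (Cn n) x y) = ratio x y • (show Cn n from X y) := by
  rw [rep, (chartAt (Cn n) x).left_inv hy]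

lemma rep_self (x : Hopf n) (X : VField n (Hopf n)) : rep x X (chartAt (Cn n) x x) = (show Cn n from X x) := by
  rw [rep_chartAt (mem_chart_source _ x), ratio_self]
  exact one_smul ℝ (show Cn n from X x)

lemma eventually_mem_target {x y : Hopf n} (hy : y ∈ (chartAt (Cn n) x).source) :
    ∀ᶠ u in 𝓝 (chartAt (Cn n) x y), u ∈ (chartAt (Cn n) x).target :=
  (chartAt (Cn n) x).open_target.mem_nhds ((chartAt (Cn n) x).map_source hy)

lemma eventually_mem_source {x y : Hopf n} (hy : y ∈ (chartAt (Cn n) x).source) :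
    ∀ᶠ y' in 𝓝 y, y' ∈ (chartAt (Cn n) x).source :=
  (chartAt (Cn n) x).open_source.mem_nhds hy

lemma mdifferentiableAt_iff_comp_symm {F : Type*} [NormedAddCommGroup F] [NormedSpace ℝ F]
    {x y : Hopf n} (hy : y ∈ (chartAt (Cn n) x).source) (f : Hopf n → F) :
    MDifferentiableAt 𝓘(ℝ, Cn n) 𝓘(ℝ, F) f y ↔
      DifferentiableAt ℝ (f ∘ (chartAt (Cn n) x).symm) (chartAt (Cn n) x y) := by
  have := isManifold_real (n := n) 1
  rw [mdifferentiableAt_iff_source_of_mem_source hy]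
  change MDifferentiableWithinAt 𝓘(ℝ, Cn n) 𝓘(ℝ, F) (f ∘ (chartAt (Cn n) x).symm) (Set.range id)
    (chartAt (Cn n) x y) ↔ _
  rw [Set.range_id, mdifferentiableWithinAt_univ, mdifferentiableAt_iff_differentiableAt]

lemma mdifferentiableAt_complex_iff_comp_symm {F : Type*} [NormedAddCommGroup F] [NormedSpace ℂ F]
    {x y : Hopf n} (hy : y ∈ (chartAt (Cn n) x).source) (f : Hopf n → F) :
    MDifferentiableAt 𝓘(ℂ, Cn n) 𝓘(ℂ, F) f y ↔
      DifferentiableAt ℂ (f ∘ (chartAt (Cn n) x).symm) (chartAt (Cn n) x y) := by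
  have := isManifold_complex (n := n) 1
  rw [mdifferentiableAt_iff_source_of_mem_source hy]
  change MDifferentiableWithinAt 𝓘(ℂ, Cn n) 𝓘(ℂ, F) (f ∘ (chartAt (Cn n) x).symm) (Set.range id)
    (chartAt (Cn n) x y) ↔ _
  rw [Set.range_id, mdifferentiableWithinAt_univ, mdifferentiableAt_iff_differentiableAt]

lemma mvfderiv_eq_fderiv {F : Type*} [NormedAddCommGroup F] [NormedSpace ℝ F] {x : Hopf n}
    {f : Hopf n → F} (hf : MDifferentiableAt 𝓘(ℝ, Cn n) 𝓘(ℝ, F) f x) (v : Cn n) :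
    mvfderiv 𝓘(ℝ, Cn n) f x v
      = fderiv ℝ (f ∘ (chartAt (Cn n) x).symm) (chartAt (Cn n) x x) v := by
  rw [mvfderiv, hf.mfderiv]
  change fderivWithin ℝ (f ∘ (chartAt (Cn n) x).symm) (Set.range id) (chartAt (Cn n) x x) v = _
  rw [Set.range_id, fderivWithin_univ]

lemma comp_symm_eventuallyEq_rep {x y : Hopf n} (hy : y ∈ (chartAt (Cn n) x).source)
    (X : VField n (Hopf n)) :
    (fun y ↦ (trivializationAt (Cn n) (TangentSpace 𝓘(ℝ, Cn n)) x ⟨y, X y⟩).2) ∘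
      (chartAt (Cn n) x).symm =ᶠ[𝓝 (chartAt (Cn n) x y)] rep x X := by
  filter_upwards [eventually_mem_target hy] with u hu
  exact trivializationAt_real ((chartAt (Cn n) x).map_target hu) _

lemma comp_symm_eventuallyEq_rep_complex {x y : Hopf n} (hy : y ∈ (chartAt (Cn n) x).source)
    (X : VField n (Hopf n)) :
    (fun y ↦ (trivializationAt (Cn n) (TangentSpace 𝓘(ℂ, Cn n)) x ⟨y, X y⟩).2) ∘
      (chartAt (Cn n) x).symm =ᶠ[𝓝 (chartAt (Cn n) x y)] rep x X := by
  filter_upwards [eventually_mem_target hy] with u hu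
  exact trivializationAt_complex ((chartAt (Cn n) x).map_target hu) _

lemma diffAt_iff {x y : Hopf n} (hy : y ∈ (chartAt (Cn n) x).source) (X : VField n (Hopf n)) :
    X.DiffAt y ↔ DifferentiableAt ℝ (rep x X) (chartAt (Cn n) x y) := by
  rw [← (comp_symm_eventuallyEq_rep hy X).differentiableAt_iff,
    ← mdifferentiableAt_iff_comp_symm hy]
  exact (trivializationAt (Cn n) (TangentSpace 𝓘(ℝ, Cn n)) x).mdifferentiableAt_section_iff
    𝓘(ℝ, Cn n) X hy

lemma mdifferentiableAt_complex_iff {x y : Hopf n} (hy : y ∈ (chartAt (Cn n) x).source)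
    (X : VField n (Hopf n)) :
    MDifferentiableAt 𝓘(ℂ, Cn n) 𝓘(ℂ, Cn n).tangent
      (fun y ↦ (⟨y, X y⟩ : TangentBundle 𝓘(ℂ, Cn n) (Hopf n))) y ↔
      DifferentiableAt ℂ (rep x X) (chartAt (Cn n) x y) := by
  rw [← (comp_symm_eventuallyEq_rep_complex hy X).differentiableAt_iff,
    ← mdifferentiableAt_complex_iff_comp_symm hy]
  exact (trivializationAt (Cn n) (TangentSpace 𝓘(ℂ, Cn n)) x).mdifferentiableAt_section_iff
    𝓘(ℂ, Cn n) X hy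

lemma contDiffAt_rep {x : Hopf n} {X : VField n (Hopf n)} (hX : X.SmoothAt x) :
    ContDiffAt ℝ ∞ (rep x X) (chartAt (Cn n) x x) := by
  have hx := mem_chart_source (Cn n) x
  have h := (Bundle.contMDiffAt_section x).1 hX
  rw [contMDiffAt_iff] at h
  have h2 := h.2
  change ContDiffWithinAt ℝ ∞ ((fun y ↦ (trivializationAt (Cn n)
    (TangentSpace 𝓘(ℝ, Cn n)) x ⟨y, X y⟩).2) ∘ (chartAt (Cn n) x).symm) (Set.range id)
    (chartAt (Cn n) x x) at h2
  rw [Set.range_id, contDiffWithinAt_univ] at h2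
  exact h2.congr_of_eventuallyEq (comp_symm_eventuallyEq_rep hx X).symm

lemma ratio_mul_ratio {x y : Hopf n} (hy : y ∈ (chartAt (Cn n) x).source) :
    ∀ᶠ y' in 𝓝 y, ratio x y' = ratio x y * ratio y y' := by
  have hyy := mem_chart_source (Cn n) y
  filter_upwards [((chartAt (Cn n) y).continuousAt hyy).eventually (eventually_chartAt_symm hy),
    eventually_mem_source hyy] with y' h1 h2
  rw [(chartAt (Cn n) y).left_inv h2] at h1
  rw [ratio, h1, norm_smul, Real.norm_of_nonneg (ratio_pos hy).le, ratio, ratio, mul_div_assoc]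

/-- The change of coordinates of a vector field. -/
lemma rep_eventuallyEq {x y : Hopf n} (hy : y ∈ (chartAt (Cn n) x).source)
    (X : VField n (Hopf n)) :
    (fun u ↦ rep x X (ratio x y • u)) =ᶠ[𝓝 (chartAt (Cn n) y y)] fun u ↦ ratio x y • rep y X u := by
  have hyy := mem_chart_source (Cn n) y
  have hc : ContinuousAt (chartAt (Cn n) y).symm (chartAt (Cn n) y y) :=
    (chartAt (Cn n) y).continuousAt_symm ((chartAt (Cn n) y).map_source hyy)
  have h0 := (chartAt (Cn n) y).left_inv hyy
  filter_upwards [eventually_chartAt_symm hy, eventually_mem_target hyy,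
    hc.eventually (by rw [h0]; exact ratio_mul_ratio hy),
    hc.eventually (by rw [h0]; exact eventually_mem_source hy)] with u h1 h2 h3 h4
  rw [rep, rep, ← h1, (chartAt (Cn n) x).left_inv h4, h3, mul_smul]

lemma fderiv_rep {x y : Hopf n} (hy : y ∈ (chartAt (Cn n) x).source) {X : VField n (Hopf n)}
    (hX : X.DiffAt y) (v : Cn n) :
    fderiv ℝ (rep x X) (chartAt (Cn n) x y) (ratio x y • v)
      = ratio x y • fderiv ℝ (rep y X) (chartAt (Cn n) y y) v := by
  have h1 := (rep_eventuallyEq hy X).fderiv_eq (𝕜 := ℝ)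
  have hX1 := (diffAt_iff hy X).1 hX
  have hX2 := (diffAt_iff (mem_chart_source _ y) X).1 hX
  rw [← ratio_smul hy] at hX1
  have h2 := hX1.hasFDerivAt.comp (chartAt (Cn n) y y) ((hasFDerivAt_id _).const_smul (ratio x y))
  rw [fderiv_fun_const_smul hX2] at h1
  have h3 := congrArg (fun L ↦ L v) (h2.fderiv.symm.trans h1)
  rw [ratio_smul hy] at h3
  exact h3

end Hopf

/-! ### Identification of the fundamental form with the explicit (1,1)-form -/

namespace HopfMetric

variable {n : ℕ}

lemma levi_I_left (u v w : Cn n) : levi u (Complex.I • v) w = -Complex.I * levi u v w := by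
  rw [levi, levi, inner_smul_left, Complex.conj_I]
  ring

lemma hasFDerivAt_log_norm_sq {u : Cn n} (hu : u ≠ 0) :
    ∃ L : Cn n →L[ℝ] ℂ, HasFDerivAt (fun x : Cn n ↦ ((Real.log (‖x‖ ^ 2) : ℝ) : ℂ)) L u ∧
      ∀ v, L v = dlog u v + conj (dlog u v) := by
  have hid := hasFDerivAt_id (𝕜 := ℝ) u
  have h3 : HasFDerivAt (fun x : Cn n ↦ (inner ℂ x x : ℂ)) _ u := HasFDerivAt.inner ℂ hid hid
  have h4 : HasFDerivAt (fun x : Cn n ↦ (inner ℂ x x : ℂ).re) _ u :=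
    Complex.reCLM.hasFDerivAt.comp u h3
  have h5 (x : Cn n) : (inner ℂ x x : ℂ).re = ‖x‖ ^ 2 := by
    rw [inner_self_eq_norm_sq_to_K]
    norm_cast
  simp only [h5] at h4
  refine ⟨_, Complex.ofRealCLM.hasFDerivAt.comp u (h4.log (by simpa using hu)), fun v ↦ ?_⟩
  have h6 : conj (inner ℂ u v) = inner ℂ v u := inner_conj_symm v u
  simp only [dlog_apply, map_mul, map_inv₀, map_pow, Complex.conj_ofReal, h6]
  apply Complex.ext
  · simp [fderivInnerCLM_apply, ← Complex.ofReal_pow, ← Complex.ofReal_inv]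
  · have h7 : (inner ℂ v u : ℂ).im = -(inner ℂ u v : ℂ).im := by rw [← h6, Complex.conj_im]
    simp [fderivInnerCLM_apply, ← Complex.ofReal_pow, ← Complex.ofReal_inv, h7]

lemma single_I_eq (i : Fin n) :
    (EuclideanSpace.single i Complex.I : Cn n) = Complex.I • EuclideanSpace.single i (1 : ℂ) := by
  ext j
  simp

lemma dzbar_log_norm_sq {u : Cn n} (hu : u ≠ 0) (j : Fin n) :
    CnForms.dzbar j (fun x : Cn n ↦ ((Real.log (‖x‖ ^ 2) : ℝ) : ℂ)) u
      = conj (dlog u (EuclideanSpace.single j 1)) := by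
  obtain ⟨L, hL, h⟩ := hasFDerivAt_log_norm_sq hu
  rw [CnForms.dzbar, hL.fderiv, h, h, single_I_eq, map_smul, smul_eq_mul, map_mul, Complex.conj_I]
  linear_combination ((dlog u (EuclideanSpace.single j 1)
    - conj (dlog u (EuclideanSpace.single j 1))) / 2) * Complex.I_mul_I

lemma dz_dzbar_log_norm_sq {u : Cn n} (hu : u ≠ 0) (i j : Fin n) :
    CnForms.dz i (CnForms.dzbar j (fun x : Cn n ↦ ((Real.log (‖x‖ ^ 2) : ℝ) : ℂ))) u
      = levi u (EuclideanSpace.single j 1) (EuclideanSpace.single i 1) := by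
  have hev : CnForms.dzbar j (fun x : Cn n ↦ ((Real.log (‖x‖ ^ 2) : ℝ) : ℂ)) =ᶠ[𝓝 u]
      fun x ↦ conj (dlog x (EuclideanSpace.single j 1)) := by
    filter_upwards [isOpen_compl_singleton.mem_nhds hu] with x hx
    exact dzbar_log_norm_sq hx j
  obtain ⟨L, hL, h⟩ := hasFDerivAt_dlog hu
    (hasFDerivAt_const (𝕜 := ℝ) (EuclideanSpace.single j (1 : ℂ) : Cn n) u)
  have hD : HasFDerivAt (fun x ↦ conj (dlog x (EuclideanSpace.single j 1))) _ u :=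
    Complex.conjCLE.toContinuousLinearMap.hasFDerivAt.comp u hL
  rw [CnForms.dz, hev.fderiv_eq, hD.fderiv, single_I_eq]
  simp only [ContinuousLinearMap.comp_apply, ContinuousLinearEquiv.coe_coe, Complex.conjCLE_apply,
    h, levi_I_left, map_smul, smul_eq_mul, zero_apply, map_zero,
    add_zero, map_sub, map_mul, map_neg, Complex.conj_I, conj_levi]
  linear_combination (-(levi u (EuclideanSpace.single j 1) (EuclideanSpace.single i 1)
    + conj (dlog u (EuclideanSpace.single i 1)) * conj (dlog u (EuclideanSpace.single j 1))) / 2)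
      * Complex.I_mul_I

lemma sum_smul_single (v : Cn n) : ∑ i, v i • (EuclideanSpace.single i 1 : Cn n) = v := by
  ext j
  simp [Finset.sum_apply, Pi.single_apply]

lemma sum_levi_single (u v w : Cn n) :
    ∑ i, ∑ j, levi u (EuclideanSpace.single j 1) (EuclideanSpace.single i 1) * (v i * conj (w j))
      = levi u w v := by
  have h1 (y x : Cn n) : levi u y x = ∑ i, x i * levi u y (EuclideanSpace.single i 1) := by
    change leviForm u y x = ∑ i, x i * leviForm u y (EuclideanSpace.single i 1)
    conv_lhs => rw [← sum_smul_single x, map_sum]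
    simp only [map_smul, smul_eq_mul]
  rw [h1]
  refine Finset.sum_congr rfl fun i _ ↦ ?_
  rw [← conj_levi, h1, map_sum, Finset.mul_sum]
  refine Finset.sum_congr rfl fun j _ ↦ ?_
  rw [map_mul, conj_levi]
  ring

lemma form11_eq (h : Fin n → Fin n → ℂ) (v w : Cn n) :
    CnForms.form11 h v w = Complex.I * ((∑ i, ∑ j, h i j * (v i * conj (w j)))
      - ∑ i, ∑ j, h i j * (w i * conj (v j))) := by
  rw [CnForms.form11]
  simp only [mul_sub, Finset.sum_sub_distrib]

lemma omega0_eq (u v w : Cn n) : CnForms.omega0 u v w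
    = Complex.I * (4 * (((‖u‖ : ℂ) ^ 2)⁻¹ * inner ℂ w v) - 4 * (((‖u‖ : ℂ) ^ 2)⁻¹ * inner ℂ v w)) := by
  have h (v w : Cn n) : ∑ i, ∑ j, (if i = j then 4 / (‖u‖ : ℂ) ^ 2 else 0) * (v i * conj (w j))
      = 4 * (((‖u‖ : ℂ) ^ 2)⁻¹ * inner ℂ w v) := by
    simp only [ite_mul, zero_mul, Finset.sum_ite_eq, Finset.mem_univ, if_true, PiLp.inner_apply,
      RCLike.inner_apply, Finset.mul_sum]
    refine Finset.sum_congr rfl fun i _ ↦ ?_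
    ring
  rw [CnForms.omega0, form11_eq, h, h]

/-- Since 2 Re(i h(v, w)) = i(h(v, w) - h(w, v)), it remains to see that h is 4⟨·,·⟩/|u|² minus 4/n
times the Levi form. -/
lemma metric_I_eq_omegaHopf {u : Cn n} (hu : u ≠ 0) (v w : Cn n) :
    (metric u (Complex.I • v) w : ℂ) = CnForms.omegaHopf u v w := by
  have h1 : (metric u (Complex.I • v) w : ℂ)
      = Complex.I * (herm u v w - herm u w v) := by
    rw [metric_apply, herm_smul_left, ← conj_herm u v w]
    apply Complex.ext <;> simp
    ring
  rw [h1, CnForms.omegaHopf, omega0_eq, CnForms.ddbar, form11_eq]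
  simp only [dz_dzbar_log_norm_sq hu, sum_levi_single]
  simp only [levi_eq, herm]
  ring

end HopfMetric

/-! ### The metric on the quotient -/

namespace Hopf

open ComplexManifold HopfMetric

variable {n : ℕ}

lemma trivializationAt_symm {x y : Hopf n} (hy : y ∈ (chartAt (Cn n) x).source) (v : Cn n) :
    (trivializationAt (Cn n) (TangentSpace 𝓘(ℝ, Cn n)) x).symm y v = (ratio x y)⁻¹ • v := by
  have h := trivializationAt_real hy
    ((trivializationAt (Cn n) (TangentSpace 𝓘(ℝ, Cn n)) x).symm y v)
  rw [(trivializationAt (Cn n) (TangentSpace 𝓘(ℝ, Cn n)) x).apply_mk_symm hy v] at h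
  change v = ratio x y • (show Cn n from _) at h
  exact (eq_inv_smul_iff₀ (ratio_pos hy).ne').2 h.symm

lemma metric_ratio_smul {x y : Hopf n} (hy : y ∈ (chartAt (Cn n) x).source) (v w : Cn n) :
    metric (chartAt (Cn n) x y) (ratio x y • v) (ratio x y • w)
      = metric (chartAt (Cn n) y y) v w := by
  rw [← ratio_smul hy, metric_smul_smul (ratio_pos hy).ne']

/-- `HopfMetric.metric` as a bilinear form on the tangent spaces. -/
def tangentInner (x : Hopf n) :
    TangentSpace 𝓘(ℝ, Cn n) x →L[ℝ] TangentSpace 𝓘(ℝ, Cn n) x →L[ℝ] ℝ :=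
  metric (chartAt (Cn n) x x)

variable (n) in
/-- The Hermitian metric on the Hopf manifold induced by `HopfMetric.metric`. -/
def hermitianMetric [NeZero n] : HermitianMetric n (Hopf n) where
  inner := tangentInner
  symm x v w := metric_comm _ _ _
  pos x v hv := metric_self_pos (chartAt_ne_zero (mem_chart_source _ x)) hv
  isVonNBounded x := isVonNBounded_metric (chartAt_ne_zero (mem_chart_source _ x))
  contMDiff x := by
    have hx := mem_chart_source (Cn n) x
    rw [contMDiffAt_hom_bundle]
    refine ⟨contMDiffAt_id, ?_⟩
    -- By dilation invariance, the metric read in the single chart at x is the coordinate formula at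
    -- every nearby point.
    have h : ContMDiffAt 𝓘(ℝ, Cn n) 𝓘(ℝ, Cn n →L[ℝ] Cn n →L[ℝ] ℝ) ∞
        (fun y ↦ metric (chartAt (Cn n) x y)) x :=
      (contDiffAt_metric (chartAt_ne_zero hx)).contMDiffAt.comp x
        (contMDiffAt_extChartAt (I := 𝓘(ℝ, Cn n)) (n := ∞) (x := x))
    refine h.congr_of_eventuallyEq ?_
    filter_upwards [eventually_mem_source hx] with y hy
    ext v w
    refine (inCoordinates_apply_eq₂ (F₃ := ℝ) (E₃ := Bundle.Trivial (Hopf n) ℝ) hy hy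
      (Set.mem_univ _)).trans ?_
    rw [trivializationAt_symm hy, trivializationAt_symm hy]
    refine (LinearMap.congr_fun
      (Bundle.Trivial.linearMapAt_trivialization ℝ (Hopf n) ℝ y) _).trans ?_
    refine (metric_ratio_smul hy _ _).symm.trans ?_
    rw [smul_inv_smul₀ (ratio_pos hy).ne', smul_inv_smul₀ (ratio_pos hy).ne']
  map_J x v w := metric_I_I _ _ _

lemma mfderiv_proj (z : Punctured n) :
    ∃ c : ℝ, 0 < c ∧ chartAt (Cn n) (proj z) (proj z) = c • (z : Cn n) ∧
      ∀ v : Cn n, mfderiv 𝓘(ℝ, Cn n) 𝓘(ℝ, Cn n) proj z v = c • v := by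
  obtain ⟨k, hk⟩ := eventually_chartAt_proj (proj z) (mem_chart_source _ (proj z))
  refine ⟨(1 / 2 : ℝ) ^ k, by positivity, hk.self_of_nhds, fun v ↦ ?_⟩
  suffices h : HasMFDerivAt 𝓘(ℝ, Cn n) 𝓘(ℝ, Cn n) proj z
      ((1 / 2 : ℝ) ^ k • ContinuousLinearMap.id ℝ (Cn n)) by
    rw [h.mfderiv]
    rfl
  refine ⟨continuous_proj.continuousAt, ?_⟩
  have h2 : HasFDerivAt (fun u : Cn n ↦ (1 / 2 : ℝ) ^ k • u)
      ((1 / 2 : ℝ) ^ k • ContinuousLinearMap.id ℝ (Cn n)) (z : Cn n) :=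
    (hasFDerivAt_id _).fun_const_smul _
  refine (h2.congr_of_eventuallyEq ?_).hasFDerivWithinAt
  have h3 := (continuousAt_extChartAt_symm (I := 𝓘(ℝ, Cn n)) z).eventually
    (by rw [extChartAt_to_inv]; exact hk)
  filter_upwards [h3, extChartAt_target_mem_nhds (I := 𝓘(ℝ, Cn n)) z] with u hu hu2
  refine hu.trans ?_
  congr 1
  exact (extChartAt 𝓘(ℝ, Cn n) z).right_inv hu2

lemma fundamentalForm_proj [NeZero n] (z : Punctured n) (v w : TangentSpace 𝓘(ℝ, Cn n) z) :
    ((hermitianMetric n).fundamentalForm (Hopf.proj z)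
        (mfderiv 𝓘(ℝ, Cn n) 𝓘(ℝ, Cn n) Hopf.proj z v)
        (mfderiv 𝓘(ℝ, Cn n) 𝓘(ℝ, Cn n) Hopf.proj z w) : ℂ)
      = CnForms.omegaHopf (z : Cn n) v w := by
  obtain ⟨c, hc, h1, h2⟩ := mfderiv_proj z
  rw [h2 v, h2 w]
  refine Eq.trans ?_ (metric_I_eq_omegaHopf z.ne_zero (show Cn n from v) (show Cn n from w))
  change ((metric (chartAt (Cn n) (proj z) (proj z))
    (Complex.I • c • (show Cn n from v)) (c • (show Cn n from w)) : ℝ) : ℂ) = _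
  rw [h1, smul_comm, metric_smul_smul hc.ne']

end Hopf

/-! ### Existence and uniqueness of the Chern connection -/

namespace Hopf

open ComplexManifold HopfMetric

variable {n : ℕ}

/-- The value of the Chern connection `∇X` at `x`. -/
def chernDeriv (X : VField n (Hopf n)) (x : Hopf n) : Cn n →L[ℝ] Cn n :=
  fderiv ℝ (rep x X) (chartAt (Cn n) x x)
    + ((christoffel (chartAt (Cn n) x x)).flip (show Cn n from X x)).restrictScalars ℝ

lemma chernDeriv_apply (X : VField n (Hopf n)) (x : Hopf n) (v : Cn n) :
    chernDeriv X x v = fderiv ℝ (rep x X) (chartAt (Cn n) x x) v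
      + christoffel (chartAt (Cn n) x x) v (show Cn n from X x) := rfl

lemma rep_add (x : Hopf n) (X Y : VField n (Hopf n)) : rep x (X + Y) = rep x X + rep x Y := by
  funext u
  exact smul_add _ (show Cn n from X _) (show Cn n from Y _)

lemma rep_smul (x : Hopf n) (f : Hopf n → ℝ) (X : VField n (Hopf n)) :
    rep x (f • X) = fun u ↦ f ((chartAt (Cn n) x).symm u) • rep x X u := by
  funext u
  exact smul_comm (ratio x _) (f _) (show Cn n from X _)

lemma rep_J (x : Hopf n) (X : VField n (Hopf n)) :
    rep x (fun y ↦ J y (X y)) = fun u ↦ Complex.I • rep x X u := by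
  funext u
  exact smul_comm _ Complex.I (show Cn n from X _)

variable (n) in
/-- The real Chern connection of the Hopf manifold. -/
def chernConnection : AffineConnection n (Hopf n) where
  toFun X x := chernDeriv X x
  isCovariantDerivativeOnUniv :=
    { add := by
        intro X Y x hX hY _
        have hx := mem_chart_source (Cn n) x
        have hX' := (diffAt_iff hx X).1 hX
        have hY' := (diffAt_iff hx Y).1 hY
        refine ContinuousLinearMap.ext fun (v : Cn n) ↦ ?_
        change chernDeriv (X + Y) x v = chernDeriv X x v + chernDeriv Y x v
        have h : (show Cn n from (X + Y) x) = (show Cn n from X x) + (show Cn n from Y x) := rfl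
        rw [chernDeriv_apply, chernDeriv_apply, chernDeriv_apply, rep_add, fderiv_add hX' hY', h,
          map_add, add_apply]
        abel
      leibniz := by
        intro X f x hX hf _
        have hx := mem_chart_source (Cn n) x
        have hX' := (diffAt_iff hx X).1 hX
        have hf' := (mdifferentiableAt_iff_comp_symm hx f).1 hf
        refine ContinuousLinearMap.ext fun (v : Cn n) ↦ ?_
        change chernDeriv (f • X) x v = f x • chernDeriv X x v
          + mvfderiv 𝓘(ℝ, Cn n) f x v • (show Cn n from X x)
        have h : (show Cn n from (f • X) x) = f x • (show Cn n from X x) := rfl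
        rw [chernDeriv_apply, chernDeriv_apply, rep_smul, mvfderiv_eq_fderiv hf]
        change fderiv ℝ (fun u ↦ (f ∘ (chartAt (Cn n) x).symm) u • rep x X u) _ _ + _ = _
        rw [fderiv_fun_smul hf' hX', h, ContinuousLinearMap.map_smul_of_tower, rep_self]
        simp only [Function.comp_apply, (chartAt (Cn n) x).left_inv hx, add_apply, smul_apply]
        rw [smul_add]
        exact add_right_comm _ _ _ }

lemma tangentInner_eventuallyEq {x : Hopf n} (X Y : VField n (Hopf n)) :
    (fun y ↦ tangentInner y (X y) (Y y)) ∘ (chartAt (Cn n) x).symm =ᶠ[𝓝 (chartAt (Cn n) x x)]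
      fun u ↦ metric u (rep x X u) (rep x Y u) := by
  filter_upwards [eventually_mem_target (mem_chart_source _ x)] with u hu
  have h := (metric_ratio_smul ((chartAt (Cn n) x).map_target hu)
    (show Cn n from X ((chartAt (Cn n) x).symm u))
    (show Cn n from Y ((chartAt (Cn n) x).symm u))).symm
  rw [(chartAt (Cn n) x).right_inv hu] at h
  exact h

lemma isRealChernConnection_chernConnection [NeZero n] :
    IsRealChernConnection (hermitianMetric n) (chernConnection n) where
  compat_metric x X Y hX hY := by
    refine fun (v : Cn n) ↦ ?_
    have hx := mem_chart_source (Cn n) x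
    have hx0 := chartAt_ne_zero hx
    have hX' := (diffAt_iff hx X).1 hX
    have hY' := (diffAt_iff hx Y).1 hY
    have hev := tangentInner_eventuallyEq (x := x) X Y
    have hd : DifferentiableAt ℝ (fun u ↦ metric u (rep x X u) (rep x Y u))
        (chartAt (Cn n) x x) :=
      (((contDiffAt_metric hx0).differentiableAt (by simp)).clm_apply hX').clm_apply hY'
    have hm : MDifferentiableAt 𝓘(ℝ, Cn n) 𝓘(ℝ, ℝ) (fun y ↦ tangentInner y (X y) (Y y)) x :=
      (mdifferentiableAt_iff_comp_symm hx _).2 (hev.differentiableAt_iff.2 hd)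
    refine (mvfderiv_eq_fderiv hm v).trans ?_
    rw [hev.fderiv_eq, fderiv_metric hx0 hX' hY', rep_self, rep_self]
    rfl
  compat_J x X hX := by
    refine fun (v : Cn n) ↦ ?_
    have hX' := (diffAt_iff (mem_chart_source _ x) X).1 hX
    change chernDeriv (fun y ↦ J y (X y)) x v = Complex.I • chernDeriv X x v
    rw [chernDeriv_apply, chernDeriv_apply, rep_J, fderiv_fun_const_smul hX', smul_add]
    congr 1
    exact map_smul (christoffel (chartAt (Cn n) x x) v) Complex.I (show Cn n from X x)
  compat_dbar x X hX := by
    refine fun (v : Cn n) ↦ ?_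
    have hX' := (mdifferentiableAt_complex_iff (mem_chart_source _ x) X).1 hX.self_of_nhds
    change chernDeriv X x (Complex.I • v) = Complex.I • chernDeriv X x v
    rw [chernDeriv_apply, chernDeriv_apply, hX'.fderiv_restrictScalars ℝ]
    simp only [ContinuousLinearMap.coe_restrictScalars', map_smul, smul_add]
    rfl

/-- The field with constant coefficients `w` in the chart at `x`. -/
def constField (x : Hopf n) (w : Cn n) : VField n (Hopf n) :=
  fun y ↦ (ratio x y)⁻¹ • w

lemma constField_self (x : Hopf n) (w : Cn n) : constField x w x = w := by
  change (ratio x x)⁻¹ • w = w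
  rw [ratio_self, inv_one, one_smul]

lemma rep_constField {x y : Hopf n} (hy : y ∈ (chartAt (Cn n) x).source) (w : Cn n) :
    rep x (constField x w) =ᶠ[𝓝 (chartAt (Cn n) x y)] fun _ ↦ w := by
  filter_upwards [eventually_mem_target hy] with u hu
  exact smul_inv_smul₀ (ratio_pos ((chartAt (Cn n) x).map_target hu)).ne' w

lemma holomorphicNear_constField (x : Hopf n) (w : Cn n) :
    (constField x w).HolomorphicNear x := by
  filter_upwards [eventually_mem_source (mem_chart_source (Cn n) x)] with y hy
  rw [mdifferentiableAt_complex_iff hy, (rep_constField hy w).differentiableAt_iff]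
  exact differentiableAt_const _

lemma diffAt_constField (x : Hopf n) (w : Cn n) : (constField x w).DiffAt x := by
  have hx := mem_chart_source (Cn n) x
  rw [diffAt_iff hx, (rep_constField hx w).differentiableAt_iff]
  exact differentiableAt_const _

/-- A connection as a linear map of the model space. -/
def coordDeriv (D : AffineConnection n (Hopf n)) (X : VField n (Hopf n)) (x : Hopf n) :
    Cn n →L[ℝ] Cn n := D X x

/-- The difference A of two Chern connections is a tensor, complex linear in both arguments and skew
for g in the field argument. Such a tensor vanishes. Constant fields in a chart are holomorphic and
realize every tangent vector, so they suffice to test A. -/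
lemma coordDeriv_eq [NeZero n] {D : AffineConnection n (Hopf n)}
    (hD : IsRealChernConnection (hermitianMetric n) D) {X : VField n (Hopf n)} {x : Hopf n}
    (hX : X.DiffAt x) : coordDeriv D X x = chernDeriv X x := by
  refine ContinuousLinearMap.ext fun v ↦ ?_
  have hE := isRealChernConnection_chernConnection (n := n)
  have hx0 := chartAt_ne_zero (mem_chart_source (Cn n) x)
  have : ContMDiffVectorBundle 1 (Cn n) (fun x : Hopf n ↦ TangentSpace 𝓘(ℝ, Cn n) x)
      𝓘(ℝ, Cn n) := inferInstance
  let A : Cn n →L[ℝ] Cn n →L[ℝ] Cn n :=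
    IsCovariantDerivativeOn.difference D.isCovariantDerivativeOnUniv
      (chernConnection n).isCovariantDerivativeOnUniv x
  have hA {Z : VField n (Hopf n)} (hZ : Z.DiffAt x) (v : Cn n) :
      A (show Cn n from Z x) v = coordDeriv D Z x v - chernDeriv Z x v :=
    congrArg (fun L ↦ L v) (IsCovariantDerivativeOn.difference_apply D.isCovariantDerivativeOnUniv
      (chernConnection n).isCovariantDerivativeOnUniv (Set.mem_univ x) hZ)
  have hA' (w v : Cn n) : A w v = coordDeriv D (constField x w) x v - chernDeriv (constField x w) x v := by
    have := hA (diffAt_constField x w) v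
    rwa [constField_self] at this
  have h1 (w w' v : Cn n) : metric (chartAt (Cn n) x x) (A w v) w'
      + metric (chartAt (Cn n) x x) w (A w' v) = 0 := by
    have e1 := hD.compat_metric x _ _ (diffAt_constField x w) (diffAt_constField x w') v
    have e2 := hE.compat_metric x _ _ (diffAt_constField x w) (diffAt_constField x w') v
    rw [e1, constField_self, constField_self] at e2
    change metric _ (coordDeriv D (constField x w) x v) w'
      + metric _ w (coordDeriv D (constField x w') x v)
      = metric _ (chernDeriv (constField x w) x v) w'
        + metric _ w (chernDeriv (constField x w') x v) at e2
    rw [hA', hA', map_sub, map_sub, sub_apply]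
    linarith
  have h2 (w v : Cn n) : A (Complex.I • w) v = Complex.I • A w v := by
    have hJ : (fun y ↦ J y (constField x w y)) = constField x (Complex.I • w) := by
      funext y
      exact smul_comm Complex.I _ w
    have e1 := hD.compat_J x _ (diffAt_constField x w) v
    have e2 := hE.compat_J x _ (diffAt_constField x w) v
    rw [hJ] at e1 e2
    rw [hA', hA', smul_sub]
    exact congrArg₂ (fun a b : Cn n ↦ a - b) e1 e2
  have h3 (w v : Cn n) : A w (Complex.I • v) = Complex.I • A w v := by
    have e1 := hD.compat_dbar x _ (holomorphicNear_constField x w) v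
    have e2 := hE.compat_dbar x _ (holomorphicNear_constField x w) v
    rw [hA', hA', smul_sub]
    exact congrArg₂ (fun a b : Cn n ↦ a - b) e1 e2
  have h4 (w v : Cn n) : A w v = 0 := by
    -- Inserting i in the direction and inserting i in the field give the same first term g(iA(w,
    -- v), w'), but opposite second terms g(iw, A(w', v)).
    have h5 (w' : Cn n) : metric (chartAt (Cn n) x x) (Complex.I • A w v) w' = 0 := by
      have e1 := h1 w w' (Complex.I • v)
      have e2 := h1 (Complex.I • w) w' v
      rw [h3, h3, metric_I_right] at e1
      rw [h2] at e2
      linarith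
    by_contra h6
    have h7 : Complex.I • A w v ≠ 0 := smul_ne_zero Complex.I_ne_zero h6
    exact (metric_self_pos hx0 h7).ne' (h5 _)
  have := hA hX v
  rw [h4] at this
  exact (sub_eq_zero.1 this.symm)

end Hopf

/-! ### Curvature on the quotient -/

namespace Hopf

open ComplexManifold HopfMetric

variable {n : ℕ}

lemma inverse_inv_smul_id {c : ℝ} (hc : c ≠ 0) :
    (c⁻¹ • ContinuousLinearMap.id ℝ (Cn n)).inverse = c • ContinuousLinearMap.id ℝ (Cn n) := by
  apply ContinuousLinearMap.inverse_eq <;> ext v <;> simp [hc]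

lemma mpullbackWithin_extChartAt_symm {x : Hopf n} {u : Cn n}
    (hu : u ∈ (chartAt (Cn n) x).target) (X : VField n (Hopf n)) :
    VectorField.mpullbackWithin 𝓘(ℝ, Cn n) 𝓘(ℝ, Cn n) (extChartAt 𝓘(ℝ, Cn n) x).symm X
      (Set.range 𝓘(ℝ, Cn n)) u = rep x X u := by
  have hy := (chartAt (Cn n) x).map_target hu
  have h1 := TangentBundle.symmL_trivializationAt (I := 𝓘(ℝ, Cn n)) hy
  have h2 : extChartAt 𝓘(ℝ, Cn n) x ((chartAt (Cn n) x).symm u) = u :=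
    (chartAt (Cn n) x).right_inv hu
  rw [h2] at h1
  have h3 : ((mfderivWithin 𝓘(ℝ, Cn n) 𝓘(ℝ, Cn n) (extChartAt 𝓘(ℝ, Cn n) x).symm
      (Set.range 𝓘(ℝ, Cn n)) u) : Cn n →L[ℝ] Cn n)
      = (ratio x ((chartAt (Cn n) x).symm u))⁻¹ • ContinuousLinearMap.id ℝ (Cn n) := by
    refine h1.symm.trans (ContinuousLinearMap.ext fun v ↦ ?_)
    refine Eq.trans ?_ (trivializationAt_symm hy v)
    exact Bundle.Trivialization.symmL_apply _ hy v
  have h4 := (congrArg ContinuousLinearMap.inverse h3).trans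
    (inverse_inv_smul_id (ratio_pos hy).ne')
  exact congrArg (fun L : Cn n →L[ℝ] Cn n ↦ L (show Cn n from X ((chartAt (Cn n) x).symm u))) h4

lemma mfderiv_extChartAt_self (x : Hopf n) :
    (mfderiv 𝓘(ℝ, Cn n) 𝓘(ℝ, Cn n) (extChartAt 𝓘(ℝ, Cn n) x) x : Cn n →L[ℝ] Cn n)
      = ContinuousLinearMap.id ℝ (Cn n) := by
  have hx := mem_chart_source (Cn n) x
  have h1 := TangentBundle.continuousLinearMapAt_trivializationAt (I := 𝓘(ℝ, Cn n)) hx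
  refine h1.symm.trans (ContinuousLinearMap.ext fun v ↦ ?_)
  rw [Bundle.Trivialization.continuousLinearMapAt_apply,
    Bundle.Trivialization.coe_linearMapAt_of_mem _ hx]
  refine (trivializationAt_real hx v).trans ?_
  rw [ratio_self]
  exact one_smul ℝ v

lemma mlieBracket_eq (X Y : VField n (Hopf n)) (x : Hopf n) :
    VectorField.mlieBracket 𝓘(ℝ, Cn n) X Y x
      = VectorField.lieBracket ℝ (rep x X) (rep x Y) (chartAt (Cn n) x x) := by
  have hx := mem_chart_source (Cn n) x
  rw [VectorField.mlieBracket, VectorField.mlieBracketWithin_apply]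
  have h0 : (mfderiv 𝓘(ℝ, Cn n) 𝓘(ℝ, Cn n) (extChartAt 𝓘(ℝ, Cn n) x) x :
      Cn n →L[ℝ] Cn n).inverse = ContinuousLinearMap.id ℝ (Cn n) :=
    (congrArg ContinuousLinearMap.inverse (mfderiv_extChartAt_self x)).trans
      ContinuousLinearMap.inverse_id
  refine (congrArg (fun L : Cn n →L[ℝ] Cn n ↦ L _) h0).trans ?_
  rw [ContinuousLinearMap.id_apply]
  have hs : (extChartAt 𝓘(ℝ, Cn n) x).symm ⁻¹' Set.univ ∩ Set.range 𝓘(ℝ, Cn n) = Set.univ := by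
    simp
  rw [hs]
  have hev (X : VField n (Hopf n)) :
      VectorField.mpullbackWithin 𝓘(ℝ, Cn n) 𝓘(ℝ, Cn n) (extChartAt 𝓘(ℝ, Cn n) x).symm X
        (Set.range 𝓘(ℝ, Cn n)) =ᶠ[𝓝 (chartAt (Cn n) x x)] rep x X := by
    filter_upwards [eventually_mem_target hx] with u hu
    exact mpullbackWithin_extChartAt_symm hu X
  have key {V W V' W' : Cn n → Cn n} {u : Cn n} (hV : V =ᶠ[𝓝 u] V') (hW : W =ᶠ[𝓝 u] W') :
      VectorField.lieBracketWithin ℝ V W Set.univ u = VectorField.lieBracket ℝ V' W' u := by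
    rw [VectorField.lieBracketWithin_univ]
    exact Filter.EventuallyEq.lieBracket_vectorField_eq hV hW
  exact key (hev X) (hev Y)

/-- The connection at a nearby point y is defined through the chart at y. Equivariance of the
derivative and of the connection form under dilations moves it to the fixed chart at x, where ∇ can
be differentiated again. -/
lemma rep_coordDeriv [NeZero n] {D : AffineConnection n (Hopf n)}
    (hD : IsRealChernConnection (hermitianMetric n) D) {Z : VField n (Hopf n)} {x : Hopf n}
    (Y : VField n (Hopf n)) (hZ : Z.SmoothAt x) :
    rep x (fun y ↦ D Z y (Y y)) =ᶠ[𝓝 (chartAt (Cn n) x x)] nabla (rep x Y) (rep x Z) := by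
  have hZ1 : ∀ᶠ u in 𝓝 (chartAt (Cn n) x x), DifferentiableAt ℝ (rep x Z) u :=
    (((contDiffAt_rep hZ).of_le (m := 1) (by simp)).eventually (by simp)).mono
      fun u hu ↦ hu.differentiableAt one_ne_zero
  filter_upwards [hZ1, eventually_mem_target (mem_chart_source _ x)] with u h1 h2
  have hy := (chartAt (Cn n) x).map_target h2
  have hu := (chartAt (Cn n) x).right_inv h2
  have hZy : Z.DiffAt ((chartAt (Cn n) x).symm u) := by
    rwa [diffAt_iff hy, hu]
  change ratio x ((chartAt (Cn n) x).symm u) • coordDeriv D Z ((chartAt (Cn n) x).symm u)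
    (show Cn n from Y ((chartAt (Cn n) x).symm u)) = _
  rw [coordDeriv_eq hD hZy, chernDeriv_apply, smul_add, ← fderiv_rep hy hZy,
    ← christoffel_smul (ratio_pos hy).ne', ratio_smul hy, hu]
  rfl

lemma coordDeriv_coordDeriv [NeZero n] {D : AffineConnection n (Hopf n)}
    (hD : IsRealChernConnection (hermitianMetric n) D) {X Y Z : VField n (Hopf n)} {x : Hopf n}
    (hY : Y.SmoothAt x) (hZ : Z.SmoothAt x) :
    coordDeriv D (fun y ↦ D Z y (Y y)) x (show Cn n from X x)
      = nabla (rep x X) (nabla (rep x Y) (rep x Z)) (chartAt (Cn n) x x) := by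
  have hx := mem_chart_source (Cn n) x
  have hev := rep_coordDeriv hD Y hZ
  -- An arbitrary connection is only controlled on differentiable fields, so this is needed before
  -- uniqueness is applied a second time.
  have hd : VField.DiffAt (fun y ↦ D Z y (Y y)) x := by
    rw [diffAt_iff hx, hev.differentiableAt_iff]
    exact differentiableAt_nabla (chartAt_ne_zero hx)
      ((contDiffAt_rep hY).differentiableAt (by simp)) ((contDiffAt_rep hZ).of_le (WithTop.coe_le_coe.2 le_top))
  rw [coordDeriv_eq hD hd, chernDeriv_apply, ← rep_self x (fun y ↦ D Z y (Y y)), hev.fderiv_eq,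
    hev.self_of_nhds, ← rep_self x X]
  rfl

lemma curvature_eq [NeZero n] {D : AffineConnection n (Hopf n)}
    (hD : IsRealChernConnection (hermitianMetric n) D) {X Y Z : VField n (Hopf n)} {x : Hopf n}
    (hX : X.SmoothAt x) (hY : Y.SmoothAt x) (hZ : Z.SmoothAt x) :
    (show Cn n from curvature D X Y Z x)
      = curvAux (chartAt (Cn n) x x) (X x) (Y x) (Z x)
        - curvAux (chartAt (Cn n) x x) (Y x) (X x) (Z x) := by
  have hx := mem_chart_source (Cn n) x
  have hd {W : VField n (Hopf n)} (hW : W.SmoothAt x) :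
      DifferentiableAt ℝ (rep x W) (chartAt (Cn n) x x) :=
    (contDiffAt_rep hW).differentiableAt (by simp)
  have h := curvature_nabla (chartAt_ne_zero hx) (hd hX) (hd hY) ((contDiffAt_rep hZ).of_le (WithTop.coe_le_coe.2 le_top))
  rw [rep_self, rep_self, rep_self] at h
  refine Eq.trans ?_ h
  rw [← coordDeriv_coordDeriv hD hY hZ, ← coordDeriv_coordDeriv hD hX hZ]
  have hb : coordDeriv D Z x (VectorField.mlieBracket 𝓘(ℝ, Cn n) X Y x)
      = nabla (fun u ↦ fderiv ℝ (rep x Y) u (rep x X u) - fderiv ℝ (rep x X) u (rep x Y u))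
        (rep x Z) (chartAt (Cn n) x x) := by
    rw [coordDeriv_eq hD ((diffAt_iff hx Z).2 (hd hZ)), mlieBracket_eq, chernDeriv_apply,
      ← rep_self x Z]
    rfl
  rw [← hb]
  rfl

lemma isRealChernRicciFlat [NeZero n] : IsRealChernRicciFlat (hermitianMetric n) := by
  refine ⟨⟨_, isRealChernConnection_chernConnection⟩, fun D hD x e X Y he hX hY hon ↦ ?_⟩
  have h0 := sum_curvAux (chartAt_ne_zero (mem_chart_source (Cn n) x)) (NeZero.ne n)
    (e := fun i ↦ (e i x : Cn n)) hon (X x)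
  have h1 : ∑ i, (show Cn n from curvature D X (e i) (e i) x) = 0 := by
    rw [← h0]
    exact Finset.sum_congr rfl fun i _ ↦ curvature_eq hD hX (he i) (he i)
  have h2 : ∑ i, metric (chartAt (Cn n) x x) (show Cn n from curvature D X (e i) (e i) x)
      (show Cn n from Y x) = 0 := by
    rw [← sum_apply, ← map_sum, h1, map_zero, zero_apply]
  exact h2

end Hopf

/-! ### The diffeomorphism with `S^{2n-1} × S^1` -/

namespace Hopf

variable {n : ℕ}

/-- The radius in the logarithmic scale, as an angle: it grows by `2π` under `z ↦ 2 z`. -/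
def logAngle (u : Cn n) : ℝ := Real.log ‖u‖ * (2 * Real.pi / Real.log 2)

lemma log_two_ne_zero : Real.log 2 ≠ 0 := (Real.log_pos one_lt_two).ne'

lemma logAngle_vadd (k : ℤ) (z : Punctured n) :
    logAngle ((k +ᵥ z : Punctured n) : Cn n) = logAngle (z : Cn n) + ((-k : ℤ) : ℝ) * (2 * Real.pi) := by
  have := log_two_ne_zero
  rw [logAngle, logAngle, Punctured.norm_vadd, Real.log_mul (zpow_ne_zero _ (by norm_num))
    (norm_ne_zero_iff.2 z.ne_zero), Real.log_zpow, one_div, Real.log_inv]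
  push_cast
  field_simp
  ring

/-- The direction of a nonzero vector, on the Hopf manifold. -/
def direction : Hopf n → Cn n :=
  Quotient.lift (fun z : Punctured n ↦ ‖(z : Cn n)‖⁻¹ • (z : Cn n)) fun z w h ↦ by
    obtain ⟨k, rfl⟩ := AddAction.orbitRel_apply.1 h
    change ‖((k +ᵥ w : Punctured n) : Cn n)‖⁻¹ • ((k +ᵥ w : Punctured n) : Cn n) = _
    have h2 : (1 / 2 : ℝ) ^ k ≠ 0 := zpow_ne_zero _ (by norm_num)
    rw [Punctured.norm_vadd, Punctured.coe_vadd, mul_inv, smul_smul]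
    congr 1
    field_simp

/-- The radius of a nonzero vector up to powers of `2`, as a point of the circle. -/
def radius : Hopf n → Circle :=
  Quotient.lift (fun z : Punctured n ↦ Circle.exp (logAngle (z : Cn n))) fun z w h ↦ by
    obtain ⟨k, rfl⟩ := AddAction.orbitRel_apply.1 h
    exact Circle.exp_eq_exp.2 ⟨-k, logAngle_vadd k w⟩

lemma direction_proj (z : Punctured n) : direction (proj z) = ‖(z : Cn n)‖⁻¹ • (z : Cn n) := rfl

lemma radius_proj (z : Punctured n) : radius (proj z) = Circle.exp (logAngle (z : Cn n)) := rfl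

lemma surjective_proj : Function.Surjective (proj (n := n)) := Quotient.mk_surjective

lemma direction_mem_sphere (x : Hopf n) : direction x ∈ Metric.sphere (0 : Cn n) 1 := by
  obtain ⟨z, rfl⟩ := surjective_proj x
  rw [direction_proj, mem_sphere_zero_iff_norm, norm_smul, norm_inv, norm_norm]
  exact inv_mul_cancel₀ (norm_ne_zero_iff.2 z.ne_zero)

lemma contDiffAt_norm_cn {u : Cn n} (hu : u ≠ 0) : ContDiffAt ℝ ∞ (fun x : Cn n ↦ ‖x‖) u :=
  contDiffAt_norm ℂ hu

lemma contMDiff_direction : ContMDiff 𝓘(ℝ, Cn n) 𝓘(ℝ, Cn n) ∞ (direction (n := n)) := by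
  intro x
  have hx := mem_chart_source (Cn n) x
  have h0 := chartAt_ne_zero hx
  have h : ContDiffAt ℝ ∞ (fun u : Cn n ↦ ‖u‖⁻¹ • u) (chartAt (Cn n) x x) :=
    ((contDiffAt_norm_cn h0).inv (norm_ne_zero_iff.2 h0)).smul contDiffAt_id
  refine (h.contMDiffAt.comp x
    (contMDiffAt_extChartAt (I := 𝓘(ℝ, Cn n)) (n := ∞) (x := x))).congr_of_eventuallyEq ?_
  filter_upwards [eventually_mem_source hx] with y hy
  conv_lhs => rw [← proj_chartAt hy]
  rfl

lemma contMDiff_radius : ContMDiff 𝓘(ℝ, Cn n) (𝓡 1) ∞ (radius (n := n)) := by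
  intro x
  have hx := mem_chart_source (Cn n) x
  have h0 := chartAt_ne_zero hx
  have h : ContDiffAt ℝ ∞ (logAngle (n := n)) (chartAt (Cn n) x x) :=
    ((contDiffAt_norm_cn h0).log (norm_ne_zero_iff.2 h0)).mul contDiffAt_const
  refine (contMDiff_circleExp.contMDiffAt.comp x (h.contMDiffAt.comp x
    (contMDiffAt_extChartAt (I := 𝓘(ℝ, Cn n)) (n := ∞) (x := x)))).congr_of_eventuallyEq ?_
  filter_upwards [eventually_mem_source hx] with y hy
  conv_lhs => rw [← proj_chartAt hy]
  rfl

open Classical in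
/-- The quotient map, extended to `ℂⁿ` by a junk value at `0`. -/
def projExt [NeZero n] (u : Cn n) : Hopf n :=
  if h : u ≠ 0 then proj ⟨u, h⟩ else
    proj ⟨EuclideanSpace.single 0 1, by
      change (EuclideanSpace.single 0 1 : Cn n) ≠ 0
      simp⟩

lemma projExt_coe [NeZero n] (z : Punctured n) : projExt (z : Cn n) = proj z := dif_pos z.ne_zero

lemma projExt_zpow_smul [NeZero n] (k : ℤ) {u : Cn n} (hu : u ≠ 0) :
    projExt ((1 / 2 : ℝ) ^ k • u) = projExt u := by
  have h := projExt_coe (k +ᵥ (⟨u, hu⟩ : Punctured n))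
  rw [Punctured.coe_vadd] at h
  exact h.trans ((proj_eq_iff.2 ⟨k, rfl⟩).trans (projExt_coe ⟨u, hu⟩).symm)

lemma contMDiffAt_projExt [NeZero n] {u : Cn n} (hu : u ≠ 0) :
    ContMDiffAt 𝓘(ℝ, Cn n) 𝓘(ℝ, Cn n) ∞ (projExt (n := n)) u := by
  let z : Punctured n := ⟨u, hu⟩
  have hz : projExt u = proj z := projExt_coe z
  obtain ⟨k, hk⟩ := eventually_chartAt_proj (proj z) (mem_chart_source _ (proj z))
  have hcomp : (projExt (n := n)) ∘ (Subtype.val : Punctured n → Cn n) = proj := funext projExt_coe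
  rw [contMDiffAt_iff_target, hz]
  constructor
  · have h := (puncturedOpens n).isOpen.isOpenEmbedding_subtypeVal.continuousAt_iff
      (g := projExt (n := n)) (x := z)
    refine h.1 ?_
    change ContinuousAt (projExt ∘ (Subtype.val : Punctured n → Cn n)) z
    rw [hcomp]
    exact continuous_proj.continuousAt
  · have h : ContDiffAt ℝ ∞ (fun u : Cn n ↦ (1 / 2 : ℝ) ^ k • u) u :=
      (contDiff_const_smul _).contDiffAt
    refine h.contMDiffAt.congr_of_eventuallyEq ?_
    rw [nhds_induced (Subtype.val : Punctured n → Cn n), Filter.eventually_comap] at hk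
    filter_upwards [hk, isOpen_compl_singleton.mem_nhds hu] with w h1 h2
    exact (congrArg (chartAt (Cn n) (proj z)) (projExt_coe ⟨w, h2⟩)).trans (h1 ⟨w, h2⟩ rfl)

/-- The point of the Hopf manifold with given direction and logarithmic radius. -/
def ofPolar [NeZero n] (s : ℝ) (p : Cn n) : Hopf n :=
  projExt (Real.exp (s * (Real.log 2 / (2 * Real.pi))) • p)

/-- Adding 2πm to the angle multiplies the vector by 2^m, which does not change its class. Hence any
branch of the argument may be used. -/
lemma ofPolar_congr [NeZero n] {s s' : ℝ} (h : Circle.exp s = Circle.exp s') {p : Cn n}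
    (hp : p ≠ 0) : ofPolar s p = ofPolar s' p := by
  obtain ⟨m, rfl⟩ := Circle.exp_eq_exp.1 h
  rw [ofPolar, ofPolar, ← projExt_zpow_smul m (smul_ne_zero (Real.exp_pos _).ne' hp), smul_smul]
  congr 2
  have h2 : (1 / 2 : ℝ) ^ m = Real.exp (-(m * Real.log 2)) := by
    rw [← Real.log_zpow, Real.exp_neg, Real.exp_log (by positivity), one_div, inv_zpow]
  rw [h2, ← Real.exp_add]
  congr 1
  field_simp
  ring

lemma ofPolar_direction [NeZero n] (x : Hopf n) :
    ofPolar (Complex.arg (radius x)) (direction x) = x := by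
  obtain ⟨z, rfl⟩ := surjective_proj x
  have hz := norm_ne_zero_iff.2 z.ne_zero
  have hd : direction (proj z) ≠ 0 := smul_ne_zero (inv_ne_zero hz) z.ne_zero
  rw [ofPolar_congr ((Circle.exp_arg _).trans (radius_proj z)) hd, ofPolar, direction_proj,
    logAngle]
  have h : Real.log ‖(z : Cn n)‖ * (2 * Real.pi / Real.log 2) * (Real.log 2 / (2 * Real.pi))
      = Real.log ‖(z : Cn n)‖ := by
    have := log_two_ne_zero
    field_simp
  rw [h, Real.exp_log (norm_pos_iff.2 z.ne_zero), smul_smul, mul_inv_cancel₀ hz, one_smul,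
    projExt_coe]

lemma projExt_ofPolar [NeZero n] (s : ℝ) {p : Cn n} (hp : ‖p‖ = 1) :
    direction (ofPolar s p) = p ∧ radius (ofPolar s p) = Circle.exp s := by
  have hp0 : p ≠ 0 := norm_ne_zero_iff.1 (by simp [hp])
  have he := Real.exp_pos (s * (Real.log 2 / (2 * Real.pi)))
  have hn : ‖Real.exp (s * (Real.log 2 / (2 * Real.pi))) • p‖
      = Real.exp (s * (Real.log 2 / (2 * Real.pi))) := by
    rw [norm_smul, hp, mul_one, Real.norm_of_nonneg he.le]
  have h : ofPolar s p = proj ⟨_, smul_ne_zero he.ne' hp0⟩ :=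
    projExt_coe (⟨_, smul_ne_zero he.ne' hp0⟩ : Punctured n)
  rw [h, direction_proj, radius_proj, logAngle]
  constructor
  · change ‖Real.exp (s * (Real.log 2 / (2 * Real.pi))) • p‖⁻¹ • _ = p
    rw [hn]
    exact inv_smul_smul₀ he.ne' p
  · change Circle.exp (Real.log ‖Real.exp (s * (Real.log 2 / (2 * Real.pi))) • p‖ * _) = _
    rw [hn, Real.log_exp]
    congr 1
    have := log_two_ne_zero
    field_simp

/-- Rotating t₀ to 1 keeps away from the cut of the argument, which is there the imaginary part of a
smooth logarithm. -/
lemma contMDiffAt_arg_mul_inv (t₀ : Circle) :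
    ContMDiffAt (𝓡 1) 𝓘(ℝ, ℝ) ∞ (fun t : Circle ↦ Complex.arg (t * t₀⁻¹ : Circle)) t₀ := by
  have h1 : ContMDiff (𝓡 1) 𝓘(ℝ, ℂ) ∞ (fun t : Circle ↦ (t : ℂ)) :=
    have : Fact (Module.finrank ℝ ℂ = 1 + 1) := finrank_real_complex_fact'
    contMDiff_coe_sphere (E := ℂ)
  have h2 : ContDiffAt ℝ ∞ (fun w : ℂ ↦ (Complex.log (w * ((t₀⁻¹ : Circle) : ℂ))).im) (t₀ : ℂ) := by
    have h3 : ContDiffAt ℝ ∞ (fun w : ℂ ↦ w * ((t₀⁻¹ : Circle) : ℂ)) (t₀ : ℂ) :=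
      contDiffAt_id.mul contDiffAt_const
    have h4 : ContDiffAt ℝ ∞ Complex.log ((t₀ : ℂ) * ((t₀⁻¹ : Circle) : ℂ)) := by
      refine (Complex.contDiffAt_log ?_).restrict_scalars ℝ
      rw [← Circle.coe_mul, mul_inv_cancel, Circle.coe_one]
      exact Complex.one_mem_slitPlane
    exact Complex.imCLM.contDiff.contDiffAt.comp _ (ContDiffAt.comp (t₀ : ℂ) (g := Complex.log) h4 h3)
  have h5 := h2.contMDiffAt.comp t₀ (h1 t₀)
  refine h5.congr_of_eventuallyEq (.of_forall fun t ↦ ?_)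
  exact (congrArg Complex.arg (Circle.coe_mul t t₀⁻¹)).trans (Complex.log_im _).symm

variable (n) in
/-- The Hopf manifold is diffeomorphic to `S^{2n-1} × S^1`. -/
def diffeomorphSphereProdCircle [NeZero n] :
    Hopf n ≃ₘ^∞⟮𝓘(ℝ, Cn n), (𝓡 (2 * n - 1)).prod (𝓡 1)⟯ (Metric.sphere (0 : Cn n) 1 × Circle) where
  toFun x := (⟨direction x, direction_mem_sphere x⟩, radius x)
  invFun q := ofPolar (Complex.arg q.2) (q.1 : Cn n)
  left_inv := ofPolar_direction
  right_inv q := by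
    obtain ⟨h1, h2⟩ := projExt_ofPolar (Complex.arg q.2) (mem_sphere_zero_iff_norm.1 q.1.2)
    exact Prod.ext (Subtype.ext h1) (h2.trans (Circle.exp_arg _))
  contMDiff_toFun :=
    (contMDiff_direction.codRestrict_sphere direction_mem_sphere).prodMk contMDiff_radius
  contMDiff_invFun := by
    rintro ⟨p₀, t₀⟩
    have hp (p : Metric.sphere (0 : Cn n) 1) : (p : Cn n) ≠ 0 :=
      norm_ne_zero_iff.1 (by simp)
    have h1 : ContMDiffAt ((𝓡 (2 * n - 1)).prod (𝓡 1)) 𝓘(ℝ, Cn n) ∞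
        (fun q : Metric.sphere (0 : Cn n) 1 × Circle ↦ (q.1 : Cn n)) (p₀, t₀) :=
      contMDiff_coe_sphere.contMDiffAt.comp _ contMDiffAt_fst
    have h2 : ContMDiffAt ((𝓡 (2 * n - 1)).prod (𝓡 1)) 𝓘(ℝ, ℝ) ∞
        (fun q : Metric.sphere (0 : Cn n) 1 × Circle ↦ Complex.arg (q.2 * t₀⁻¹ : Circle)) (p₀, t₀) :=
      ContMDiffAt.comp (p₀, t₀) (g := fun t : Circle ↦ Complex.arg (t * t₀⁻¹ : Circle))
        (contMDiffAt_arg_mul_inv t₀) contMDiffAt_snd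
    have h3 : ContDiff ℝ ∞ (fun s : ℝ ↦ Real.exp ((s + Complex.arg t₀) *
        (Real.log 2 / (2 * Real.pi)))) :=
      Real.contDiff_exp.comp ((contDiff_id.add contDiff_const).mul contDiff_const)
    -- The principal argument in the inverse map is replaced by the branch arg(t t₀⁻¹) + arg t₀,
    -- smooth near t₀. It has the same exponential, so the point of the quotient is unchanged.
    let f : Metric.sphere (0 : Cn n) 1 × Circle → Cn n := fun q ↦
      Real.exp ((Complex.arg (q.2 * t₀⁻¹ : Circle) + Complex.arg t₀) *
        (Real.log 2 / (2 * Real.pi))) • (q.1 : Cn n)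
    have h4 : ContMDiffAt ((𝓡 (2 * n - 1)).prod (𝓡 1)) 𝓘(ℝ, Cn n) ∞ f (p₀, t₀) :=
      (h3.contMDiff.contMDiffAt.comp _ h2).smul h1
    have h5 := ContMDiffAt.comp (f := f) (p₀, t₀)
      (contMDiffAt_projExt (smul_ne_zero (Real.exp_pos _).ne' (hp p₀))) h4
    refine h5.congr_of_eventuallyEq (.of_forall fun q ↦ ?_)
    refine ofPolar_congr ?_ (hp q.1)
    rw [Circle.exp_add, Circle.exp_arg, Circle.exp_arg, Circle.exp_arg, inv_mul_cancel_right]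

end Hopf

end

theorem theorem1p4 (n : ℕ) [NeZero n] :
    -- the Hopf manifold is `S^{2n-1} × S^1`
    Nonempty (Hopf n ≃ₘ^∞⟮𝓘(ℝ, Cn n), (𝓡 (2 * n - 1)).prod (𝓡 1)⟯
      (Metric.sphere (0 : Cn n) 1 × Circle)) ∧
    ∃ g : ComplexManifold.HermitianMetric n (Hopf n),
      -- the pull-back of the fundamental form of `g` is `ω₀ - (4/n) √-1 ∂∂̄ log |z|²`
      (∀ (z : Punctured n) (v w : TangentSpace 𝓘(ℝ, Cn n) z),
        (g.fundamentalForm (Hopf.proj z)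
            (mfderiv 𝓘(ℝ, Cn n) 𝓘(ℝ, Cn n) Hopf.proj z v)
            (mfderiv 𝓘(ℝ, Cn n) 𝓘(ℝ, Cn n) Hopf.proj z w) : ℂ)
          = CnForms.omegaHopf (z : Cn n) v w) ∧
      ComplexManifold.IsRealChernRicciFlat g :=
  ⟨⟨Hopf.diffeomorphSphereProdCircle n⟩, Hopf.hermitianMetric n, Hopf.fundamentalForm_proj,
    Hopf.isRealChernRicciFlat⟩
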